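/- Let $n\ge 1$, let $A$ be an exponentially distributed random variable with mean $\mu_A^{-1}\in(0,\infty)$, and let $S$ be a non-negative random variable with $\mathbb P(S=0)=0$ and mean $\mathbb E[S]=\mu_S^{-1}\in(0,\infty)$. For a non-negative random variable $X$ with finite positive mean let $R(X)$ denote a random variable with the residual life distribution $\mathbb P(R(X)>z)=\mathbb E[X]^{-1}\int_z^\infty \mathbb P(X>y)\,dy$, $z\ge 0$. An equilibrium renewal process with renewal distribution $X$ is a counting process with independent inter-event times of which the first is distributed as $R(X)$ and all others as $X$. Let $\mathcal Q_2$ be the first-come-first-serve $M/GI/n$ queue with i.i.d. inter-arrival times distributed as $A$ and i.i.d. processing times distributed as $S$, started as follows. At time $0$ there are $Z$ jobs in system, where $Z$ is Poisson with mean $\mu_A/\mu_S$; their initial processing times are i.i.d. distributed as $R(S)$, independent of $Z$. If $Z\ge n$, a uniformly random set of exactly $n$ initial jobs is processed initially and the remaining initial jobs queue for processing (ahead of all later arrivals); if $Z<n$, all initial jobs are processed from time $0$. The first inter-arrival time is distributed as $R(A)$. The number $Z$, the random selection (and order of service) of the initial jobs, the initial processing times, the inter-arrival times and the processing times of the arriving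 jobs are mutually independent. Let $Q_2(t)$ be the number in system (in service or waiting) at time $t$. Let $N_1(t),\dots,N_n(t)$ be i.i.d. equilibrium renewal processes with renewal distribution $S$, and let $A(t)$ be an independent equilibrium renewal process with renewal distribution $A$. Then for all $x>0$ and $t\ge 0$, $$\mathbb P\big((Q_2(t)-n)^+>x\big)\ \ge\ \mathbb P(Z\ge n)\,\sup_{0\le s\le t}\mathbb P\Big(A(s)-\sum_{i=1}^n N_i(s)>x\Big).$$ If in addition $Q_2(t)$ converges weakly, as $t\to\infty$, to (the law of) a random variable $Q(\infty)$, then for all $x>0$, $$\mathbb P\big((Q(\infty)-n)^+>x\big)\ \ge\ \mathbb P(Z\ge n)\,\sup_{t\ge 0}\mathbb P\Big(A(t)-\sum_{i=1}^n N_i(t)>x\Big).$$ -/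

import Mathlib

open MeasureTheory ProbabilityTheory

noncomputable section

/-- The residual life distribution `R(X)` of a non-negative random variable `X` with law `ν` and
finite positive mean: it is carried by `(0, ∞)` with density `y ↦ P(X > y) / E[X]`, so that
`P(R(X) > z) = E[X]⁻¹ ∫_z^∞ P(X > y) dy` for `z ≥ 0`. -/
def residualLife (ν : Measure ℝ) : Measure ℝ :=
  (volume.restrict (Set.Ioi 0)).withDensity
    (fun y => ENNReal.ofReal (ν.real (Set.Ioi y) / ∫ x, x ∂ν))

/-- `V 0, V 1, …` are the inter-event times of an equilibrium renewal process with renewal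
distribution `ν`: they are independent, the first one has the residual life distribution of `ν`,
and all the others have law `ν`. -/
structure IsEquilibriumRenewal {Ω : Type*} [MeasurableSpace Ω] (P : Measure Ω) (ν : Measure ℝ)
    (V : ℕ → Ω → ℝ) : Prop where
  measurable : ∀ k, Measurable (V k)
  law_first : P.map (V 0) = residualLife ν
  law_succ : ∀ k, P.map (V (k + 1)) = ν
  indep : iIndepFun V P

/-- The time of the `k`-th event (`k = 0, 1, …`) when the successive inter-event times are
`V 0, V 1, …`. -/
def eventTime (V : ℕ → ℝ) (k : ℕ) : ℝ := ∑ j ∈ Finset.range (k + 1), V j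

/-- The number of events in `[0, t]` when the successive inter-event times are `V 0, V 1, …`. -/
def eventCount (V : ℕ → ℝ) (t : ℝ) : ℕ := {k : ℕ | eventTime V k ≤ t}.ncard

/-- First-Come-First-Serve with `n` servers. The jobs `0, 1, …` are listed in their order of
priority (order of arrival); job `k` arrives at time `a k` and needs processing time `p k`.
Its processing starts at the first time `t` such that it has arrived, processing of all the jobs
before it has started, and fewer than `n` of these are being processed at `t`. -/
def startTime (n : ℕ) (a p : ℕ → ℝ) (k : ℕ) : ℝ :=
  sInf {t : ℝ | a k ≤ t ∧ (∀ j : Fin k, startTime n a p j ≤ t) ∧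
    {j : Fin k | startTime n a p j ≤ t ∧ t < startTime n a p j + p j}.ncard < n}
termination_by k
decreasing_by all_goals exact j.2

/-- The number of jobs in system (in service or waiting in queue) at time `t` in the FCFS queue
with `n` servers, arrival times `a` and processing times `p`: those that have arrived and have not
departed by time `t`. -/
def numberInSystem (n : ℕ) (a p : ℕ → ℝ) (t : ℝ) : ℕ :=
  {k : ℕ | a k ≤ t ∧ t < startTime n a p k + p k}.ncard

/-- Arrival times with `z` jobs present at time `0`, followed by arrivals with inter-arrival times
`u 0, u 1, …`. -/
def arrivalTimes (z : ℕ) (u : ℕ → ℝ) (k : ℕ) : ℝ :=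
  if k < z then 0 else eventTime u (k - z)

/-- Processing times: the `z` initial jobs are labelled by `0, …, z - 1`, the label of the `k`-th
of them in the order of service is `σ k`, and label `i` carries the initial processing time `r i`.
The later arrivals carry the processing times `s 0, s 1, …`. -/
def processingTimes (z : ℕ) (σ : ℕ → ℕ) (r s : ℕ → ℝ) (k : ℕ) : ℝ :=
  if k < z then r (σ k) else s (k - z)

/-- The random data of the FCFS `M/GI/n` queue with arrival rate `μA`, processing time
distribution `ν` of mean `μS⁻¹`, started from a Poisson number of jobs:
* `Z`, the number of initial jobs, is Poisson with mean `μA / μS`;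
* `ord m 0, …, ord m (m - 1)` is the order in which the initial jobs are served if there are `m`
  of them; if `n ≤ m` the set of the first `n`, which are processed from time `0` on, is uniformly
  distributed among the subsets of size `n`;
* `R i`, the initial processing times of the initial jobs, are i.i.d. with the residual life
  distribution of `ν`;
* `U k` are the inter-arrival times, i.i.d. exponential, the first one with the residual life
  distribution;
* `S k`, the processing times of the arriving jobs, are i.i.d. with law `ν`;
* `Z`, `ord`, `R`, `U`, `S` are mutually independent. -/
structure IsMGInData {Ω : Type*} [MeasurableSpace Ω] (P : Measure Ω) (n : ℕ) (μA μS : ℝ)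
    (ν : Measure ℝ) (Z : Ω → ℕ) (ord : ℕ → ℕ → Ω → ℕ) (R U S : ℕ → Ω → ℝ) : Prop where
  measurable_Z : Measurable Z
  law_Z : P.map Z = poissonMeasure (μA / μS).toNNReal
  measurable_ord : ∀ m k, Measurable (ord m k)
  bijOn_ord : ∀ m ω, Set.BijOn (fun k => ord m k ω) (Set.Iio m) (Set.Iio m)
  uniform_ord : ∀ m, n ≤ m → ∀ C : Finset ℕ, C ⊆ Finset.range m → C.card = n →
    P {ω | (Finset.range n).image (fun k => ord m k ω) = C} = ((m.choose n : ℕ) : ENNReal)⁻¹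
  measurable_R : ∀ i, Measurable (R i)
  law_R : ∀ i, P.map (R i) = residualLife ν
  indep_R : iIndepFun R P
  arrivals : IsEquilibriumRenewal P (expMeasure μA) U
  measurable_S : ∀ k, Measurable (S k)
  law_S : ∀ k, P.map (S k) = ν
  indep_S : iIndepFun S P
  indep_Z_rest : IndepFun Z (fun ω => ((fun m k => ord m k ω : ℕ → ℕ → ℕ),
    (fun i => R i ω : ℕ → ℝ), (fun k => U k ω : ℕ → ℝ), (fun k => S k ω : ℕ → ℝ))) P
  indep_ord_rest : IndepFun (fun ω => (fun m k => ord m k ω : ℕ → ℕ → ℕ))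
    (fun ω => ((fun i => R i ω : ℕ → ℝ), (fun k => U k ω : ℕ → ℝ), (fun k => S k ω : ℕ → ℝ))) P
  indep_R_rest : IndepFun (fun ω => (fun i => R i ω : ℕ → ℝ))
    (fun ω => ((fun k => U k ω : ℕ → ℝ), (fun k => S k ω : ℕ → ℝ))) P
  indep_U_S : IndepFun (fun ω => (fun k => U k ω : ℕ → ℝ)) (fun ω => (fun k => S k ω : ℕ → ℝ)) P

/-- The number in system `Q₂(t)` in the `n`-server FCFS queue with the given random data. -/
def queueNumber {Ω : Type*} (n : ℕ) (Z : Ω → ℕ) (ord : ℕ → ℕ → Ω → ℕ) (R U S : ℕ → Ω → ℝ)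
    (t : ℝ) (ω : Ω) : ℕ :=
  numberInSystem n (arrivalTimes (Z ω) (fun k => U k ω))
    (processingTimes (Z ω) (fun k => ord (Z ω) k ω) (fun i => R i ω) (fun k => S k ω)) t

end

/-!
Fix `s ≤ t` and put `h = t - s`. Compare the queue with the infinite-server system that has the same
jobs. The infinite-server system is stationary: at time `h` it holds a Poisson number of jobs with
mean `μA / μS` whose residual processing times are independent with law `residualLife ν`,
independently of everything that arrives afterwards. Hence, on an event of probability `P(Z ≥ n)`,
there are `n` jobs that have not received their full processing time by time `h` even if all jobs
are served upon arrival, and the amounts that are left are independent with law `residualLife ν`.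

Delete all jobs but these `n` and the arrivals after time `h`, and let the `n` jobs start at time
`h` at the latest, one on each server. In a First-Come-First-Serve queue this does not increase the
number of jobs present at time `t` (`sum_leInd_le_departures`, `le_numberInSystem_add_departures`,
`lt_numberInSystem_of_mem_overloadSet`): each job still starts only after one of any `n` jobs
before it has departed. In the remaining system, the jobs of each server depart no earlier than the
events of an equilibrium renewal process, so that the number of departures in `(h, t]` is
stochastically at most `∑ i, N i (s)`; this is an induction on the number of arrivals in which the
processing time of the next job is used as the next inter-event time of the server that is free
first (`measure_renewal_le_measure_departures`). The arrivals in `(h, t]` number `A(s)`, and the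
bound for a fixed `s` follows. For the steady state, `Q₂(t) - n > x` is a closed condition on the
integer `Q₂(t)`, and the portmanteau theorem applies.

To keep the residual processing times independent, the `n` jobs are not selected by a rule; instead
the argument averages over all `n`-tuples of jobs present in the infinite-server system
(`averageAlive`). This turns stationarity into an identity for the mean of such an average,
`tsum_poissonMeasure_mul_lintegral_averageAtTime`. It follows from the classical description of the
arrivals up to time `h` as a Poisson population (`lintegral_arrivedUpTo`,
`setLIntegral_decreasingAges`), from superposition with the initial jobs (`tsum_lintegral_pi_add`),
from thinning (`populationIntegral_smul_smul`), and from the fact that the intensity of the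
residual processing times is invariant (`restrict_residual_eq`).
-/

noncomputable section

/-! ### Comparison of the queue with a system that starts from `n` busy servers -/

/-- The indicator of `x ≤ s`, with values in `[0, ∞]`. -/
def leInd (s x : ℝ) : ENNReal := if x ≤ s then 1 else 0

lemma measurable_leInd (s : ℝ) : Measurable (leInd s) :=
  Measurable.ite measurableSet_Iic measurable_const measurable_const

lemma leInd_antitone {s x y : ℝ} (h : x ≤ y) : leInd s y ≤ leInd s x := by
  unfold leInd
  split_ifs with h1 h2
  · exact le_rfl
  · exact absurd (h.trans h1) h2
  · exact zero_le
  · exact le_rfl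

section
variable {n : ℕ} [NeZero n]

lemma exists_forall_apply_le (f : Fin n → ℝ) :
    (Finset.univ.filter (fun i => ∀ j, f i ≤ f j)).Nonempty := by
  obtain ⟨i, hi⟩ := Finite.exists_min f
  exact ⟨i, by simpa using hi⟩

/-- The server that is free first when server `i` gets free at time `f i`; ties are broken in favour
of the smaller label. -/
def firstFree (f : Fin n → ℝ) : Fin n :=
  (Finset.univ.filter (fun i => ∀ j, f i ≤ f j)).min' (exists_forall_apply_le f)

lemma apply_firstFree_le (f : Fin n → ℝ) (j : Fin n) : f (firstFree f) ≤ f j := by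
  have := Finset.min'_mem _ (exists_forall_apply_le f)
  exact (Finset.mem_filter.1 this).2 j

lemma firstFree_eq_iff (f : Fin n → ℝ) (i : Fin n) :
    firstFree f = i ↔ (∀ j, f i ≤ f j) ∧ ∀ j, (∀ l, f j ≤ f l) → i ≤ j := by
  constructor
  · rintro rfl
    exact ⟨apply_firstFree_le f, fun j hj => Finset.min'_le _ _ (by simpa using hj)⟩
  · rintro ⟨h1, h2⟩
    exact le_antisymm (Finset.min'_le _ _ (by simpa using h1)) (h2 _ (apply_firstFree_le f))

lemma measurable_firstFree : Measurable (firstFree : (Fin n → ℝ) → Fin n) := by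
  refine measurable_to_countable' fun i => ?_
  have h : ∀ i : Fin n, MeasurableSet {f : Fin n → ℝ | ∀ j, f i ≤ f j} := fun i => by
    rw [Set.ofPred_forall]
    exact MeasurableSet.iInter fun j =>
      measurableSet_le (measurable_pi_apply i) (measurable_pi_apply j)
  have h' : MeasurableSet {f : Fin n → ℝ | ∀ j, (∀ l, f j ≤ f l) → i ≤ j} := by
    rw [Set.ofPred_forall]
    exact MeasurableSet.iInter fun j => (h j).imp (MeasurableSet.const _)
  have : firstFree ⁻¹' {i} = {f : Fin n → ℝ | ∀ j, f i ≤ f j} ∩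
      {f : Fin n → ℝ | ∀ j, (∀ l, f j ≤ f l) → i ≤ j} := by
    ext f; exact firstFree_eq_iff f i
  rw [this]
  exact (h i).inter h'

/-- The free times of the servers after a job with arrival time `τ` and processing time `p` has been
given to the server that is free first. -/
def assignJob (f : Fin n → ℝ) (τ p : ℝ) : Fin n → ℝ :=
  Function.update f (firstFree f) (max τ (f (firstFree f)) + p)

lemma measurable_assignJob :
    Measurable (fun q : (Fin n → ℝ) × ℝ × ℝ => assignJob q.1 q.2.1 q.2.2) := by
  have hm : Measurable (fun q : (Fin n → ℝ) × ℝ × ℝ => q.1 (firstFree q.1)) := by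
    have : Measurable (fun q : ((Fin n → ℝ) × ℝ × ℝ) × Fin n => q.1.1 q.2) :=
      measurable_from_prod_countable_left fun i => (measurable_pi_apply i).comp measurable_fst
    exact this.comp (measurable_id.prodMk (measurable_firstFree.comp measurable_fst))
  refine measurable_pi_iff.2 fun i => ?_
  simp only [assignJob, Function.update_apply]
  refine Measurable.ite ?_ (by fun_prop) (by fun_prop)
  have : {q : (Fin n → ℝ) × ℝ × ℝ | i = firstFree q.1}
      = (fun q : (Fin n → ℝ) × ℝ × ℝ => firstFree q.1) ⁻¹' {i} := by
    ext q; simp [eq_comm]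
  rw [this]
  exact (measurable_firstFree.comp measurable_fst) (measurableSet_singleton i)

/-- The number of departures up to time `s` from `n` servers of which server `i` is busy with an
initial job until `f i`, and which then process `M` further jobs First-Come-First-Serve, with
arrival times `τ 0, τ 1, …` and processing times `p 0, p 1, …`. Each job is given to the server
that is free first; a departure is counted when the server is given its next job, and at the end
for the last job of each server. -/
def departures (s : ℝ) : ℕ → (ℕ → ℝ) → (Fin n → ℝ) → (ℕ → ℝ) → ENNReal
  | 0, _, f, _ => ∑ i, leInd s (f i)
  | M + 1, τ, f, p => leInd s (f (firstFree f)) +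
      departures s M (fun k => τ (k + 1)) (assignJob f (τ 0) (p 0)) (fun k => p (k + 1))

lemma measurable_departures (s : ℝ) (M : ℕ) :
    Measurable (fun q : (ℕ → ℝ) × (Fin n → ℝ) × (ℕ → ℝ) => departures s M q.1 q.2.1 q.2.2) := by
  induction M with
  | zero =>
    simp only [departures]
    exact Finset.measurable_sum _ fun i _ => (measurable_leInd s).comp (by fun_prop)
  | succ M ih =>
    simp only [departures]
    refine Measurable.add ?_ ?_
    · refine (measurable_leInd s).comp ?_
      have : Measurable (fun q : (Fin n → ℝ) × Fin n => q.1 q.2) :=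
        measurable_from_prod_countable_left fun i => measurable_pi_apply i
      exact this.comp ((measurable_fst.comp measurable_snd).prodMk
        (measurable_firstFree.comp (measurable_fst.comp measurable_snd)))
    · refine ih.comp (Measurable.prodMk (by fun_prop) (Measurable.prodMk ?_ (by fun_prop)))
      exact measurable_assignJob.comp (f := fun q : (ℕ → ℝ) × (Fin n → ℝ) × (ℕ → ℝ) =>
        (q.2.1, q.1 0, q.2.2 0)) (by fun_prop)

/-- The servers of `departures` are given their jobs at the earliest times that any system with `n`
servers allows. Here `dep k` is the departure time of job `k` in a system in which each job starts
after its arrival, and, whenever `n` jobs precede it, after the departure of one of them. -/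
lemma sum_leInd_le_departures (s : ℝ) (dep a p : ℕ → ℝ) (h_arr : ∀ q, a q + p q ≤ dep q)
    (h_wait : ∀ q (c : Fin n → ℕ), Function.Injective c → (∀ i, c i < q) →
      ∃ i, dep (c i) + p q ≤ dep q) (M : ℕ) :
    ∀ (q : ℕ) (c : Fin n → ℕ) (f : Fin n → ℝ), Function.Injective c → (∀ i, c i < q) →
      (∀ i, f i ≤ dep (c i)) →
      (∑ i, leInd s (dep (c i))) + ∑ l ∈ Finset.range M, leInd s (dep (q + l))
        ≤ departures s M (fun l => a (q + l)) f (fun l => p (q + l)) := by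
  induction M with
  | zero =>
    intro q c f _ _ hf
    simpa [departures] using Finset.sum_le_sum fun i _ => leInd_antitone (hf i)
  | succ M ih =>
    intro q c f hc hq hf
    set i := firstFree f with hi
    obtain ⟨j, hj⟩ := h_wait q c hc hq
    have h1 : assignJob f (a q) (p q) i ≤ dep q := by
      simp only [assignJob, ← hi, Function.update_self]
      rcases max_cases (a q) (f i) with h | h
      · rw [h.1]; exact h_arr q
      · rw [h.1]; linarith [apply_firstFree_le f j, hf j]
    have hc' : Function.Injective (Function.update c i q) := by
      intro k l hkl
      by_cases hk : k = i <;> by_cases hl : l = i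
      · rw [hk, hl]
      · subst hk; rw [Function.update_self, Function.update_of_ne hl] at hkl
        exact absurd hkl (hq l).ne'
      · subst hl; rw [Function.update_self, Function.update_of_ne hk] at hkl
        exact absurd hkl (hq k).ne
      · rw [Function.update_of_ne hk, Function.update_of_ne hl] at hkl; exact hc hkl
    have hq' : ∀ k, Function.update c i q k < q + 1 := by
      intro k
      by_cases hk : k = i
      · subst hk; simp
      · rw [Function.update_of_ne hk]; exact (hq k).trans (Nat.lt_succ_self q)
    have hf' : ∀ k, assignJob f (a q) (p q) k ≤ dep (Function.update c i q k) := by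
      intro k
      by_cases hk : k = i
      · subst hk; rw [Function.update_self]; exact h1
      · rw [Function.update_of_ne hk, assignJob, ← hi, Function.update_of_ne hk]; exact hf k
    have key := ih (q + 1) (Function.update c i q) (assignJob f (a q) (p q)) hc' hq' hf'
    have e1 : ∑ k, leInd s (dep (c k)) =
        leInd s (dep (c i)) + ∑ k ∈ Finset.univ.erase i, leInd s (dep (c k)) :=
      (Finset.add_sum_erase _ _ (Finset.mem_univ i)).symm
    have e2 : ∑ k, leInd s (dep (Function.update c i q k)) =
        leInd s (dep q) + ∑ k ∈ Finset.univ.erase i, leInd s (dep (c k)) := by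
      rw [← Finset.add_sum_erase _ _ (Finset.mem_univ i), Function.update_self]
      congr 1
      exact Finset.sum_congr rfl fun k hk => by
        rw [Function.update_of_ne (Finset.ne_of_mem_erase hk)]
    rw [e2] at key
    have e3 : ∀ x : ℕ → ℝ, (fun l => x (q + (l + 1))) = fun l => x (q + 1 + l) := fun x => by
      funext l; congr 1; ring
    have e4 : ∑ l ∈ Finset.range M, leInd s (dep (q + (l + 1))) =
        ∑ l ∈ Finset.range M, leInd s (dep (q + 1 + l)) :=
      Finset.sum_congr rfl fun l _ => by rw [congrFun (e3 dep) l]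
    rw [e1, Finset.sum_range_succ', departures, e3 a, e3 p, e4]
    calc leInd s (dep (c i)) + ∑ k ∈ Finset.univ.erase i, leInd s (dep (c k)) +
          (∑ l ∈ Finset.range M, leInd s (dep (q + 1 + l)) + leInd s (dep q))
        = leInd s (dep (c i)) + (leInd s (dep q) + ∑ k ∈ Finset.univ.erase i, leInd s (dep (c k))
          + ∑ l ∈ Finset.range M, leInd s (dep (q + 1 + l))) := by ring
      _ ≤ _ := add_le_add (leInd_antitone (hf i)) key

end

lemma startTime_set_nonempty {n : ℕ} (hn : 0 < n) (a p : ℕ → ℝ) (k : ℕ) :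
    {t : ℝ | a k ≤ t ∧ (∀ j : Fin k, startTime n a p j ≤ t) ∧
      {j : Fin k | startTime n a p j ≤ t ∧ t < startTime n a p j + p j}.ncard < n}.Nonempty := by
  obtain ⟨B, hB⟩ := (Set.finite_range (fun j : Fin k => startTime n a p j)).bddAbove
  obtain ⟨B', hB'⟩ := (Set.finite_range (fun j : Fin k => startTime n a p j + p j)).bddAbove
  refine ⟨max (a k) (max B B'), le_max_left _ _, fun j =>
    (hB ⟨j, rfl⟩).trans ((le_max_left _ _).trans (le_max_right _ _)), ?_⟩
  convert hn
  rw [Set.ncard_eq_zero, Set.eq_empty_iff_forall_notMem]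
  rintro j ⟨-, hj⟩
  exact absurd hj (not_lt.2 ((hB' ⟨j, rfl⟩).trans ((le_max_right _ _).trans (le_max_right _ _))))

lemma le_startTime {n : ℕ} (hn : 0 < n) (a p : ℕ → ℝ) (k : ℕ) : a k ≤ startTime n a p k := by
  rw [startTime]
  exact le_csInf (startTime_set_nonempty hn a p k) fun t ht => ht.1

/-- When a job starts, one of any `n` jobs before it has departed. -/
lemma exists_departure_le_startTime {n : ℕ} (hn : 0 < n) (a p : ℕ → ℝ) (q : ℕ) (c : Fin n → ℕ)
    (hc : Function.Injective c) (hq : ∀ i, c i < q) :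
    ∃ i, startTime n a p (c i) + p (c i) ≤ startTime n a p q := by
  by_contra! h
  have : Nonempty (Fin n) := ⟨⟨0, hn⟩⟩
  obtain ⟨i₀, hi₀⟩ := Finite.exists_min fun i => startTime n a p (c i) + p (c i)
  have h0 := h i₀
  rw [startTime] at h0
  obtain ⟨t, ⟨-, ht1, ht2⟩, ht⟩ := exists_lt_of_csInf_lt (startTime_set_nonempty hn a p q) h0
  refine absurd ht2 (not_lt.2 ?_)
  have : Set.range (fun i : Fin n => (⟨c i, hq i⟩ : Fin q)) ⊆
      {j : Fin q | startTime n a p j ≤ t ∧ t < startTime n a p j + p j} := by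
    rintro _ ⟨i, rfl⟩
    exact ⟨ht1 ⟨c i, hq i⟩, ht.trans_le (hi₀ i)⟩
  calc n = (Set.range (fun i : Fin n => (⟨c i, hq i⟩ : Fin q))).ncard := by
        rw [Set.ncard_range_of_injective (fun i j hij => hc (by simpa using hij))]; simp
    _ ≤ _ := Set.ncard_le_ncard this (Set.toFinite _)

lemma sum_leInd_add_card {ι : Type*} (A : Finset ι) (d : ι → ℝ) (t : ℝ) :
    ∑ i ∈ A, leInd t (d i) + ((A.filter fun i => t < d i).card : ENNReal) = A.card := by
  have : ∑ i ∈ A, leInd t (d i) = ((A.filter fun i => ¬ t < d i).card : ENNReal) := by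
    simp only [leInd, not_lt, Finset.sum_boole]
  rw [this, add_comm, ← Nat.cast_add, Finset.card_filter_add_card_filter_not]

/-- If `n` jobs with labels below `q` would not depart before the times `h + y i` even if they were
served upon arrival, and the jobs that arrive up to time `t` are those below `q + M`, then the
number in system at time `t` is at least what remains at that time of these `n` jobs and of the `M`
jobs from `q` on, when `n` servers start at time `h` from remaining processing times `y`. -/
lemma le_numberInSystem_add_departures {n : ℕ} [NeZero n] (a p : ℕ → ℝ) (h t : ℝ) (q M : ℕ)
    (c : Fin n → ℕ) (y : Fin n → ℝ) (hc : Function.Injective c) (hq : ∀ i, c i < q)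
    (ha : ∀ k, a k ≤ t ↔ k < q + M) (hy : ∀ i, h + y i ≤ a (c i) + p (c i)) :
    (n : ENNReal) + M ≤ numberInSystem n a p t +
      departures (t - h) M (fun l => a (q + l) - h) y (fun l => p (q + l)) := by
  have hn : 0 < n := Nat.pos_of_ne_zero (NeZero.ne n)
  set D : ℕ → ℝ := fun k => startTime n a p k + p k with hD
  have harr : ∀ k, a k + p k ≤ D k := fun k => by
    have := le_startTime hn a p k
    simp only [hD]; linarith
  have h1 := sum_leInd_le_departures (n := n) (t - h) (fun k => D k - h) (fun k => a k - h) p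
    (fun k => by have := harr k; linarith) (fun k c hc hk => by
      obtain ⟨i, hi⟩ := exists_departure_le_startTime hn a p k c hc hk
      exact ⟨i, by simp only [hD]; linarith⟩) M q c y hc hq
    (fun i => by have := harr (c i); have := hy i; linarith)
  have hl : ∀ x : ℝ, leInd (t - h) (x - h) = leInd t x := fun x => by simp [leInd]
  simp only [hl] at h1
  have h2 := sum_leInd_add_card Finset.univ (fun i => D (c i)) t
  have h3 := sum_leInd_add_card (Finset.range M) (fun l => D (q + l)) t
  have h4 : ((Finset.univ.filter fun i : Fin n => t < D (c i)).card +
      ((Finset.range M).filter fun l => t < D (q + l)).card) ≤ numberInSystem n a p t := by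
    rw [← Finset.card_image_of_injective _ hc,
      ← Finset.card_image_of_injective (Finset.filter _ (Finset.range M)) (add_right_injective q),
      ← Finset.card_union_of_disjoint, numberInSystem, ← Set.ncard_coe_finset]
    · refine Set.ncard_le_ncard ?_ ((Set.finite_Iio (q + M)).subset fun k hk => (ha k).1 hk.1)
      intro k hk
      simp only [Finset.coe_union, Finset.coe_image, Finset.coe_filter, Set.mem_union,
        Set.mem_image, Set.mem_ofPred_eq, Finset.mem_univ, true_and, Finset.mem_range] at hk
      rcases hk with ⟨i, hi, rfl⟩ | ⟨l, ⟨hl, hl'⟩, rfl⟩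
      · exact ⟨(ha _).2 ((hq i).trans_le (Nat.le_add_right _ _)), hi⟩
      · exact ⟨(ha _).2 (by omega), hl'⟩
    · rw [Finset.disjoint_left]
      intro k hk hk'
      obtain ⟨i, -, rfl⟩ := Finset.mem_image.1 hk
      obtain ⟨l, -, hl⟩ := Finset.mem_image.1 hk'
      have := hq i; omega
  simp only [Finset.card_univ, Fintype.card_fin, Finset.card_range] at h2 h3
  rw [← h2, ← h3]
  calc _ = (((Finset.univ.filter fun i : Fin n => t < D (c i)).card +
      ((Finset.range M).filter fun l => t < D (q + l)).card : ℕ) : ENNReal) +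
      (∑ i, leInd t (D (c i)) + ∑ l ∈ Finset.range M, leInd t (D (q + l))) := by
        push_cast; ring
    _ ≤ _ := add_le_add (by exact_mod_cast h4) h1

/-! ### Sequences of independent random variables -/

/-- The sequence `x, V 0, V 1, …`. -/
def seqCons {α : Type*} (x : α) (V : ℕ → α) : ℕ → α
  | 0 => x
  | k + 1 => V k

@[simp] lemma seqCons_zero {α : Type*} (x : α) (V : ℕ → α) : seqCons x V 0 = x := rfl

@[simp] lemma seqCons_succ {α : Type*} (x : α) (V : ℕ → α) (k : ℕ) :
    seqCons x V (k + 1) = V k := rfl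

lemma measurable_seqCons {α : Type*} [MeasurableSpace α] :
    Measurable (fun q : α × (ℕ → α) => seqCons q.1 q.2) := by
  refine measurable_pi_iff.2 fun k => ?_
  cases k with
  | zero => exact measurable_fst
  | succ k => exact (measurable_pi_apply k).comp measurable_snd

lemma measurePreserving_seqCons {α : Type*} [MeasurableSpace α] (μ : ℕ → Measure α)
    [∀ k, IsProbabilityMeasure (μ k)] :
    MeasurePreserving (fun q : α × (ℕ → α) => seqCons q.1 q.2)
      ((μ 0).prod (Measure.infinitePi fun k => μ (k + 1))) (Measure.infinitePi μ) := by
  refine ⟨measurable_seqCons, ?_⟩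
  refine Measure.eq_infinitePi μ fun s t ht => ?_
  classical
  obtain ⟨N, hN⟩ := s.exists_nat_subset_range
  set t' : ℕ → Set α := fun k => if k ∈ s then t k else Set.univ with ht'
  have hm : ∀ k, MeasurableSet (t' k) := fun k => by
    simp only [ht']; split_ifs with h
    · exact ht k
    · exact MeasurableSet.univ
  have h1 : Set.pi (s : Set ℕ) t = Set.pi (Finset.range (N + 1) : Set ℕ) t' := by
    ext x
    simp only [Set.mem_pi, Finset.mem_coe, ht', Finset.mem_range]
    constructor
    · intro h k _
      split_ifs with hk
      · exact h k hk
      · trivial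
    · intro h k hk
      have := h k (by have := hN hk; simp at this; omega)
      rwa [if_pos hk] at this
  have h2 : ∏ i ∈ s, μ i (t i) = ∏ i ∈ Finset.range (N + 1), μ i (t' i) := by
    refine Finset.prod_subset_one_on_sdiff (fun k hk => ?_) (fun k hk => ?_) (fun k hk => ?_)
    · have := hN hk; simp at this ⊢; omega
    · simp [ht', (Finset.mem_sdiff.1 hk).2]
    · simp [ht', hk]
  have hms : MeasurableSet (Set.pi (Finset.range (N + 1) : Set ℕ) t') :=
    MeasurableSet.pi (Finset.countable_toSet _) fun k _ => hm k
  rw [h1, h2, Measure.map_apply measurable_seqCons hms]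
  have h3 : (fun q : α × (ℕ → α) => seqCons q.1 q.2) ⁻¹'
      (Set.pi (Finset.range (N + 1) : Set ℕ) t') =
      t' 0 ×ˢ Set.pi (Finset.range N : Set ℕ) (fun k => t' (k + 1)) := by
    ext q
    simp only [Set.mem_preimage, Set.mem_pi, Finset.mem_coe, Finset.mem_range, Set.mem_prod]
    constructor
    · intro h
      exact ⟨h 0 (Nat.succ_pos _), fun k hk => h (k + 1) (Nat.succ_lt_succ hk)⟩
    · rintro ⟨h0, h⟩ k hk
      cases k with
      | zero => exact h0
      | succ k => exact h k (Nat.lt_of_succ_lt_succ hk)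
  rw [h3, Measure.prod_prod, Measure.infinitePi_pi _ (fun k _ => hm _), Finset.prod_range_succ',
    mul_comm]

/-- The law of a sequence of independent random variables with law `ν`. -/
abbrev iidLaw {α : Type*} [MeasurableSpace α] (ν : Measure α) [IsProbabilityMeasure ν] :
    Measure (ℕ → α) :=
  Measure.infinitePi fun _ => ν

/-- Prepending an independent entry to one of the independent sequences does not change the joint
law. -/
lemma measurePreserving_update_seqCons {ι α : Type*} [Fintype ι] [DecidableEq ι]
    [MeasurableSpace α] (ν : Measure α) [IsProbabilityMeasure ν] (i : ι) :
    MeasurePreserving (fun q : α × (ι → ℕ → α) => Function.update q.2 i (seqCons q.1 (q.2 i)))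
      (ν.prod (Measure.pi fun _ => iidLaw ν)) (Measure.pi fun _ => iidLaw ν) := by
  have hm : Measurable (fun q : α × (ι → ℕ → α) =>
      Function.update q.2 i (seqCons q.1 (q.2 i))) := by
    refine measurable_pi_iff.2 fun j => ?_
    by_cases hj : j = i
    · subst hj
      simp only [Function.update_self]
      exact measurable_seqCons.comp (measurable_fst.prodMk (by fun_prop))
    · simp only [Function.update_of_ne hj]; fun_prop
  refine ⟨hm, (Measure.pi_eq fun B hB => ?_).symm⟩
  have hms : MeasurableSet (Set.pi Set.univ B) := MeasurableSet.univ_pi hB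
  rw [Measure.map_apply hm hms, Measure.prod_apply (hm hms)]
  have h1 : ∀ v : α, Prod.mk v ⁻¹' ((fun q : α × (ι → ℕ → α) =>
      Function.update q.2 i (seqCons q.1 (q.2 i))) ⁻¹' Set.pi Set.univ B) =
      Set.pi Set.univ (Function.update B i (seqCons v ⁻¹' B i)) := by
    intro v
    ext V
    simp only [Set.mem_preimage, Set.mem_pi, Set.mem_univ, true_imp_iff]
    refine forall_congr' fun j => ?_
    by_cases hj : j = i
    · subst hj; simp
    · simp [Function.update_of_ne hj]
  have h2 : ∀ v : α, (Measure.pi fun _ : ι => iidLaw ν)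
      (Set.pi Set.univ (Function.update B i (seqCons v ⁻¹' B i))) =
      (iidLaw ν (seqCons v ⁻¹' B i)) * ∏ j ∈ Finset.univ.erase i, iidLaw ν (B j) := by
    intro v
    rw [Measure.pi_pi, ← Finset.mul_prod_erase _ _ (Finset.mem_univ i), Function.update_self]
    congr 1
    exact Finset.prod_congr rfl fun j hj => by
      rw [Function.update_of_ne (Finset.ne_of_mem_erase hj)]
  have hp := measurePreserving_seqCons (fun _ : ℕ => ν)
  simp only [h1, h2]
  have hmi : Measurable fun v : α => iidLaw ν (seqCons v ⁻¹' B i) :=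
    measurable_measure_prodMk_left (hp.measurable (hB i))
  rw [lintegral_mul_const _ hmi]
  rw [← Finset.mul_prod_erase _ _ (Finset.mem_univ i)]
  congr 1
  rw [← hp.measure_preimage (hB i).nullMeasurableSet, Measure.prod_apply (hp.measurable (hB i))]
  rfl

/-! ### Departures and renewal processes -/

lemma eventTime_seqCons_zero (x : ℝ) (V : ℕ → ℝ) : eventTime (seqCons x V) 0 = x := by
  simp [eventTime]

lemma eventTime_seqCons_succ (x : ℝ) (V : ℕ → ℝ) (k : ℕ) :
    eventTime (seqCons x V) (k + 1) = x + eventTime V k := by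
  simp only [eventTime]
  rw [Finset.sum_range_succ' _ (k + 1)]
  simp [add_comm]

lemma measurable_eventTime (k : ℕ) : Measurable (fun V : ℕ → ℝ => eventTime V k) := by
  unfold eventTime; fun_prop

/-- The number of events up to time `s`, as an extended non-negative real number, so that infinitely
many events count as `∞`. -/
def eventCountENN (V : ℕ → ℝ) (s : ℝ) : ENNReal := ∑' k, leInd s (eventTime V k)

lemma measurable_eventCountENN (s : ℝ) : Measurable (fun V => eventCountENN V s) :=
  Measurable.tsum fun k => (measurable_leInd s).comp (measurable_eventTime k)

lemma eventCountENN_seqCons (x : ℝ) (V : ℕ → ℝ) (s : ℝ) :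
    eventCountENN (seqCons x V) s = leInd s x + ∑' k, leInd s (x + eventTime V k) := by
  rw [eventCountENN, tsum_eq_zero_add' ENNReal.summable, eventTime_seqCons_zero]
  simp only [eventTime_seqCons_succ]

lemma eventCountENN_seqCons_antitone {x y : ℝ} (h : x ≤ y) (V : ℕ → ℝ) (s : ℝ) :
    eventCountENN (seqCons y V) s ≤ eventCountENN (seqCons x V) s := by
  rw [eventCountENN_seqCons, eventCountENN_seqCons]
  exact add_le_add (leInd_antitone h)
    (ENNReal.tsum_le_tsum fun k => leInd_antitone (by linarith))

lemma eventCountENN_seqCons_seqCons (x v : ℝ) (V : ℕ → ℝ) (s : ℝ) :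
    eventCountENN (seqCons x (seqCons v V)) s =
      leInd s x + eventCountENN (seqCons (x + v) V) s := by
  rw [eventCountENN_seqCons, eventCountENN]
  congr 1
  refine tsum_congr fun k => ?_
  cases k with
  | zero => simp [eventTime_seqCons_zero]
  | succ k => simp [eventTime_seqCons_succ, add_assoc]

/-- The number of departures from the servers is stochastically smaller than the number of events of
independent renewal processes, one for each server: if the next job is given to server `i` at a
time `≥ f i`, its departure time is at least that of a job started at `f i`, which is the next event
of the renewal process of server `i`. -/
lemma measure_renewal_le_measure_departures {n : ℕ} [NeZero n] (ν : Measure ℝ)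
    [IsProbabilityMeasure ν] (s : ℝ) (d : ENNReal) (M : ℕ) :
    ∀ (τ : ℕ → ℝ) (f : Fin n → ℝ) (b : ENNReal),
      (Measure.pi fun _ : Fin n => iidLaw ν)
          {V | b + ∑ i, eventCountENN (seqCons (f i) (V i)) s < d} ≤
        iidLaw ν {p | b + departures s M τ f p < d} := by
  induction M with
  | zero =>
    intro τ f b
    by_cases h : b + ∑ i, leInd s (f i) < d
    · simp only [departures, h, Set.ofPred_true, measure_univ]
      exact prob_le_one
    · refine le_of_eq_of_le ((congrArg _ ?_).trans measure_empty) bot_le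
      ext V
      simp only [Set.mem_ofPred_eq, Set.mem_empty_iff_false, iff_false, not_lt]
      refine (not_lt.1 h).trans (add_le_add le_rfl (Finset.sum_le_sum fun i _ => ?_))
      rw [eventCountENN_seqCons]
      exact le_self_add
  | succ M ih =>
    intro τ f b
    set i := firstFree f with hi
    set ℓ := leInd s (f i) with hℓ
    have hp := measurePreserving_seqCons (fun _ : ℕ => ν)
    have hq := measurePreserving_update_seqCons ν i
    have hmV : Measurable fun V : Fin n → ℕ → ℝ =>
        b + ∑ i, eventCountENN (seqCons (f i) (V i)) s := by
      refine measurable_const.add (Finset.measurable_sum _ fun j _ => ?_)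
      exact (measurable_eventCountENN s).comp (measurable_seqCons.comp
        (measurable_const.prodMk (measurable_pi_apply j)))
    have hmD : Measurable fun p : ℕ → ℝ => b + departures s (M + 1) τ f p :=
      measurable_const.add ((measurable_departures s (M + 1)).comp
        (measurable_const.prodMk (measurable_const.prodMk measurable_id)))
    have hV : MeasurableSet {V : Fin n → ℕ → ℝ |
        b + ∑ i, eventCountENN (seqCons (f i) (V i)) s < d} := measurableSet_lt hmV measurable_const
    have hD : MeasurableSet {p : ℕ → ℝ | b + departures s (M + 1) τ f p < d} :=
      measurableSet_lt hmD measurable_const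
    rw [← hp.measure_preimage hD.nullMeasurableSet, ← hq.measure_preimage hV.nullMeasurableSet,
      Measure.prod_apply (hp.measurable hD), Measure.prod_apply (hq.measurable hV)]
    refine lintegral_mono fun v => ?_
    refine le_trans (measure_mono ?_) ((ih (fun k => τ (k + 1)) (assignJob f (τ 0) v)
      (b + ℓ)).trans (measure_mono ?_))
    · intro V hVV
      simp only [Set.mem_preimage, Set.mem_ofPred_eq] at hVV ⊢
      refine lt_of_le_of_lt ?_ hVV
      rw [add_assoc]
      refine add_le_add le_rfl ?_
      rw [← Finset.add_sum_erase _ _ (Finset.mem_univ i),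
        ← Finset.add_sum_erase (a := i) _ _ (Finset.mem_univ i), ← add_assoc,
        Function.update_self, eventCountENN_seqCons_seqCons]
      refine add_le_add (add_le_add le_rfl ?_) (le_of_eq ?_)
      · refine eventCountENN_seqCons_antitone ?_ _ _
        simp only [assignJob, ← hi, Function.update_self]
        linarith [le_max_right (τ 0) (f i)]
      · refine Finset.sum_congr rfl fun j hj => ?_
        have hj' := Finset.ne_of_mem_erase hj
        rw [assignJob, ← hi, Function.update_of_ne hj', Function.update_of_ne hj']
    · intro p hpp
      simp only [Set.mem_preimage, Set.mem_ofPred_eq, departures] at hpp ⊢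
      simpa [add_assoc, hℓ, hi] using hpp

/-! ### Superposition and thinning of Poisson populations -/

section
variable {n : ℕ} {ι κ : Type*} [Fintype ι] [Fintype κ]

open Classical in
/-- The individuals `i : ι` have residual lives `x i` and are alive if `0 < x i`. This is the
average of `G` over the residual lives of all ordered `n`-tuples of distinct living individuals; if
there are fewer than `n` of them, it is `0 / 0 = 0`. -/
def averageAlive (G : (Fin n → ℝ) → ENNReal) (x : ι → ℝ) : ENNReal :=
  (∑ e : Fin n ↪ ι, if ∀ a, 0 < x (e a) then G (fun a => x (e a)) else 0) /
    ∑ e : Fin n ↪ ι, if ∀ a, 0 < x (e a) then 1 else 0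

lemma averageAlive_le {G : (Fin n → ℝ) → ENNReal} {x : ι → ℝ} {c : ENNReal}
    (h : ∀ e : Fin n ↪ ι, (∀ a, 0 < x (e a)) → G (fun a => x (e a)) ≤ c) :
    averageAlive G x ≤ c := by
  classical
  refine ENNReal.div_le_of_le_mul ?_
  rw [Finset.mul_sum]
  refine Finset.sum_le_sum fun e _ => ?_
  split_ifs with he
  · simpa using h e he
  · simp

lemma averageAlive_comp_equiv (G : (Fin n → ℝ) → ENNReal) (σ : ι ≃ κ) (x : κ → ℝ) :
    averageAlive G (fun i => x (σ i)) = averageAlive G x := by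
  classical
  unfold averageAlive
  congr 1
  · exact Fintype.sum_equiv (Equiv.embeddingCongr (Equiv.refl _) σ) _ _ fun e => by simp
  · exact Fintype.sum_equiv (Equiv.embeddingCongr (Equiv.refl _) σ) _ _ fun e => by simp

lemma measurable_averageAlive_uncurry {β : Type*} [MeasurableSpace β]
    {G : (Fin n → ℝ) × β → ENNReal} (hG : Measurable G) :
    Measurable (fun q : (ι → ℝ) × β => averageAlive (fun y => G (y, q.2)) q.1) := by
  classical
  have h : ∀ e : Fin n ↪ ι, MeasurableSet {q : (ι → ℝ) × β | ∀ a, 0 < q.1 (e a)} := fun e => by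
    rw [Set.ofPred_forall]
    exact MeasurableSet.iInter fun a => measurableSet_lt measurable_const (by fun_prop)
  unfold averageAlive
  refine Measurable.div (Finset.measurable_sum _ fun e _ => ?_)
    (Finset.measurable_sum _ fun e _ => ?_)
  · exact Measurable.ite (h e) (hG.comp (by fun_prop)) measurable_const
  · exact Measurable.ite (h e) measurable_const measurable_const

lemma measurable_averageAlive {G : (Fin n → ℝ) → ENNReal} (hG : Measurable G) :
    Measurable (averageAlive (ι := ι) G) :=
  (measurable_averageAlive_uncurry (β := Unit) (hG.comp measurable_fst)).comp
    (measurable_id.prodMk (measurable_const (a := ())))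

lemma lintegral_averageAlive {β : Type*} [MeasurableSpace β] (μ : Measure β)
    {G : (Fin n → ℝ) × β → ENNReal} (hG : Measurable G) (x : ι → ℝ) :
    ∫⁻ w, averageAlive (fun y => G (y, w)) x ∂μ =
      averageAlive (fun y => ∫⁻ w, G (y, w) ∂μ) x := by
  classical
  unfold averageAlive
  simp only [div_eq_mul_inv]
  have h : ∀ e : Fin n ↪ ι, Measurable fun w =>
      if ∀ a, 0 < x (e a) then G (fun a => x (e a), w) else 0 := fun e => by
    split_ifs
    · exact hG.comp (by fun_prop)
    · exact measurable_const
  rw [lintegral_mul_const _ (Finset.measurable_sum _ fun e _ => h e),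
    lintegral_finsetSum _ fun e _ => h e]
  congr 1
  refine Finset.sum_congr rfl fun e _ => ?_
  split_ifs <;> simp

lemma lintegral_pi_comp_equiv {α : Type*} [MeasurableSpace α] (σ : ι ≃ κ) (μ : κ → Measure α)
    [∀ k, SigmaFinite (μ k)] (F : (κ → α) → ENNReal) :
    ∫⁻ y, F (fun k => y (σ.symm k)) ∂Measure.pi (fun i => μ (σ i)) = ∫⁻ x, F x ∂Measure.pi μ := by
  rw [← (measurePreserving_piCongrLeft (α := fun _ => α) μ σ).map_eq, lintegral_map_equiv]
  refine lintegral_congr fun y => ?_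
  congr 1
  funext k
  obtain ⟨i, rfl⟩ := σ.surjective k
  rw [MeasurableEquiv.coe_piCongrLeft, Equiv.piCongrLeft_apply_apply, σ.symm_apply_apply]

lemma pi_add [DecidableEq ι] {α : Type*} [MeasurableSpace α] (M N : Measure α) [IsFiniteMeasure M]
    [IsFiniteMeasure N] :
    Measure.pi (fun _ : ι => M + N) =
      ∑ T : Finset ι, Measure.pi (fun i => if i ∈ T then M else N) := by
  have hf : ∀ (T : Finset ι) i, IsFiniteMeasure (if i ∈ T then M else N) := fun T i => by
    split_ifs <;> infer_instance
  refine (Measure.pi_eq fun B hB => ?_)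
  simp only [Measure.finsetSum_apply, Measure.pi_pi, Measure.add_apply, Fintype.prod_add]
  refine Finset.sum_congr rfl fun T _ => ?_
  rw [← Finset.prod_mul_prod_compl T]
  congr 1
  · exact Finset.prod_congr rfl fun i hi => by rw [if_pos hi]
  · exact Finset.prod_congr rfl fun i hi => by rw [if_neg (Finset.mem_compl.1 hi)]

lemma pi_smul {α : ι → Type*} [∀ i, MeasurableSpace (α i)] (c : ι → ENNReal) (hc : ∀ i, c i ≠ ⊤)
    (μ : ∀ i, Measure (α i)) [∀ i, IsFiniteMeasure (μ i)] :
    Measure.pi (fun i => c i • μ i) = (∏ i, c i) • Measure.pi μ := by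
  have hf : ∀ i, IsFiniteMeasure (c i • μ i) := fun i => Measure.smul_finite _ (hc i)
  refine Measure.pi_eq fun B hB => ?_
  simp [Finset.prod_mul_distrib]

/-- The integral of `averageAlive G` over a population of `z` individuals with measure `M` and
`m` individuals with measure `N`. -/
def populationIntegral (G : (Fin n → ℝ) → ENNReal) (M N : Measure ℝ) (z m : ℕ) : ENNReal :=
  ∫⁻ x : Fin z ⊕ Fin m → ℝ, averageAlive G x
    ∂Measure.pi (Sum.elim (fun _ => M) (fun _ => N))

lemma lintegral_pi_add (G : (Fin n → ℝ) → ENNReal) (M N : Measure ℝ)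
    [IsFiniteMeasure M] [IsFiniteMeasure N] (k : ℕ) :
    ∫⁻ x : Fin k → ℝ, averageAlive G x ∂Measure.pi (fun _ => M + N) =
      ∑ j ∈ Finset.HasAntidiagonal.antidiagonal k,
        (k.choose j.1 : ENNReal) * populationIntegral G M N j.1 j.2 := by
  rw [pi_add, lintegral_finsetSum_measure]
  have h : ∀ T : Finset (Fin k), ∫⁻ x : Fin k → ℝ, averageAlive G x
      ∂Measure.pi (fun i => if i ∈ T then M else N) =
      populationIntegral G M N T.card (k - T.card) := by
    intro T
    have hT : Tᶜ.card = k - T.card := by rw [Finset.card_compl, Fintype.card_fin]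
    set σ := finSumEquivOfFinset rfl hT
    have hf : ∀ i, IsFiniteMeasure (if i ∈ T then M else N) := fun i => by
      split_ifs <;> infer_instance
    rw [← lintegral_pi_comp_equiv σ (fun i => if i ∈ T then M else N), populationIntegral]
    have e1 : (fun i => if σ i ∈ T then M else N) = Sum.elim (fun _ => M) (fun _ => N) := by
      funext i
      rcases i with i | i
      · rw [if_pos]; · rfl
        simp [σ]
      · rw [if_neg]; · rfl
        have : (Tᶜ.orderEmbOfFin hT) i ∈ Tᶜ := Finset.orderEmbOfFin_mem _ _ _
        simpa only [σ, finSumEquivOfFinset_inr, Finset.mem_compl] using this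
    rw [e1]
    exact lintegral_congr fun y => averageAlive_comp_equiv G σ.symm y
  rw [Finset.sum_congr rfl fun T _ => h T, ← Finset.powerset_univ,
    Finset.sum_powerset_apply_card (fun j => populationIntegral G M N j (k - j)),
    Finset.Nat.sum_antidiagonal_eq_sum_range_succ
      (fun i j => (k.choose i : ENNReal) * populationIntegral G M N i j)]
  simp [nsmul_eq_mul]

lemma tsum_sum_antidiagonal (f : ℕ × ℕ → ENNReal) :
    ∑' k, ∑ j ∈ Finset.HasAntidiagonal.antidiagonal k, f j = ∑' z, ∑' m, f (z, m) := by
  rw [← ENNReal.tsum_prod, ← Finset.HasAntidiagonal.sigmaAntidiagonalEquivProd.tsum_eq f,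
    ENNReal.tsum_sigma']
  refine tsum_congr fun k => ?_
  rw [tsum_fintype, ← Finset.sum_coe_sort]
  rfl

/-- Superposition: the union of two independent Poisson populations with intensity measures `M` and
`N` is a Poisson population with intensity measure `M + N`. -/
lemma tsum_lintegral_pi_add (G : (Fin n → ℝ) → ENNReal) (M N : Measure ℝ)
    [IsFiniteMeasure M] [IsFiniteMeasure N] :
    ∑' k : ℕ, (k.factorial : ENNReal)⁻¹ *
        ∫⁻ x : Fin k → ℝ, averageAlive G x ∂Measure.pi (fun _ => M + N) =
      ∑' z : ℕ, ∑' m : ℕ, (z.factorial : ENNReal)⁻¹ * (m.factorial : ENNReal)⁻¹ *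
        populationIntegral G M N z m := by
  rw [← tsum_sum_antidiagonal fun j => (j.1.factorial : ENNReal)⁻¹ * (j.2.factorial : ENNReal)⁻¹ *
        populationIntegral G M N j.1 j.2]
  refine tsum_congr fun k => ?_
  rw [lintegral_pi_add, Finset.mul_sum]
  refine Finset.sum_congr rfl fun j hj => ?_
  obtain rfl := Finset.HasAntidiagonal.mem_antidiagonal.1 hj
  rw [← mul_assoc]
  congr 1
  have h0 : ∀ i : ℕ, (i.factorial : ENNReal) ≠ 0 := fun i => by
    exact_mod_cast i.factorial_ne_zero
  have ht : ∀ i : ℕ, (i.factorial : ENNReal) ≠ ⊤ := fun i => ENNReal.natCast_ne_top _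
  have e : ((j.1 + j.2).choose j.1 : ENNReal) * j.1.factorial * j.2.factorial =
      (j.1 + j.2).factorial := by
    rw [Nat.choose_symm_add]
    exact_mod_cast Nat.add_choose_mul_factorial_mul_factorial j.1 j.2
  rw [← ENNReal.mul_inv (Or.inl (h0 _)) (Or.inl (ht _)), ← e]
  rw [mul_assoc, ENNReal.mul_inv (Or.inr (ENNReal.mul_ne_top (ht _) (ht _)))
    (Or.inr (mul_ne_zero (h0 _) (h0 _))), mul_comm, ← mul_assoc, ENNReal.mul_inv_cancel, one_mul]
  · exact_mod_cast (Nat.choose_pos (Nat.le_add_right _ _)).ne'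
  · exact ENNReal.natCast_ne_top _

lemma map_pi_comp_injective {α : Type*} [MeasurableSpace α] {μ : ι → Measure α}
    [∀ i, IsProbabilityMeasure (μ i)] {e : κ → ι} (he : Function.Injective e) :
    (Measure.pi μ).map (fun x k => x (e k)) = Measure.pi fun k => μ (e k) := by
  rw [← Measure.infinitePi_eq_pi, ← Measure.infinitePi_eq_pi]
  exact Measure.map_infinitePi_infinitePi_of_inj he

/-- Thinning: if all individuals of the first kind and no others are alive, then the residual lives
of an `n`-tuple of living individuals are independent, regardless of which tuple is taken. -/
lemma populationIntegral_smul_smul {G : (Fin n → ℝ) → ENNReal} (hG : Measurable G)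
    (R N : Measure ℝ) [IsProbabilityMeasure R] [IsProbabilityMeasure N] (hR : R (Set.Iic 0) = 0)
    (hN : N (Set.Ioi 0) = 0) {r b : ENNReal} (hr : r ≠ ⊤) (hb : b ≠ ⊤) (z m : ℕ) :
    populationIntegral G (r • R) (b • N) z m =
      r ^ z * b ^ m * if n ≤ z then ∫⁻ y, G y ∂Measure.pi (fun _ : Fin n => R) else 0 := by
  classical
  set μ : Fin z ⊕ Fin m → Measure ℝ := Sum.elim (fun _ => R) (fun _ => N) with hμ
  have hp : ∀ i, IsProbabilityMeasure (μ i) := by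
    rintro (i | i) <;> simp only [hμ, Sum.elim_inl, Sum.elim_inr] <;> infer_instance
  have e1 : (Sum.elim (fun _ => r • R) (fun _ => b • N) : Fin z ⊕ Fin m → Measure ℝ) =
      fun i => (Sum.elim (fun _ => r) (fun _ => b) i : ENNReal) • μ i := by
    funext i; rcases i with i | i <;> rfl
  rw [populationIntegral, e1, pi_smul _ (by rintro (i | i) <;> simp [hr, hb]),
    lintegral_smul_measure, Fintype.prod_sum_type]
  simp only [Sum.elim_inl, Sum.elim_inr, Finset.prod_const, Finset.card_univ, Fintype.card_fin,
    smul_eq_mul]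
  congr 1
  -- Almost surely, the living individuals are those of the first kind.
  have hae : ∀ᵐ x ∂Measure.pi μ, ∀ i, 0 < x i ↔ i.isLeft := by
    rw [ae_all_iff]
    intro i
    have hq := (measurePreserving_eval μ i).quasiMeasurePreserving
    rcases i with i | i
    · have : ∀ᵐ y ∂(μ (Sum.inl i)), 0 < y := by
        rw [ae_iff]; simp only [hμ, Sum.elim_inl, not_lt]; exact hR
      filter_upwards [hq.ae this] with x hx
      simpa using hx
    · have : ∀ᵐ y ∂(μ (Sum.inr i)), ¬ 0 < y := by
        rw [ae_iff]; simp only [hμ, Sum.elim_inr, not_not]; exact hN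
      filter_upwards [hq.ae this] with x hx
      simpa using hx
  have h2 : ∫⁻ x, averageAlive G x ∂Measure.pi μ =
      ∫⁻ x, (∑ e : Fin n ↪ Fin z ⊕ Fin m, if ∀ a, (e a).isLeft then G (fun a => x (e a)) else 0) /
        (∑ e : Fin n ↪ Fin z ⊕ Fin m, if ∀ a, (e a).isLeft then 1 else 0) ∂Measure.pi μ := by
    refine lintegral_congr_ae ?_
    filter_upwards [hae] with x hx
    simp only [averageAlive, hx]
  have hGm : ∀ e : Fin n ↪ Fin z ⊕ Fin m, Measurable fun x : Fin z ⊕ Fin m → ℝ =>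
      if ∀ a, (e a).isLeft then G (fun a => x (e a)) else 0 := fun e => by
    split_ifs
    · exact hG.comp (by fun_prop)
    · exact measurable_const
  have h3 : ∀ e : Fin n ↪ Fin z ⊕ Fin m,
      ∫⁻ x, (if ∀ a, (e a).isLeft then G (fun a => x (e a)) else 0) ∂Measure.pi μ =
      (∫⁻ y, G y ∂Measure.pi (fun _ : Fin n => R)) * if ∀ a, (e a).isLeft then 1 else 0 := by
    intro e
    split_ifs with he
    · have h4 : (fun k => μ (e k)) = fun _ => R := by
        funext k
        have := he k
        rcases h : e k with i | i
        · rfl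
        · simp [h] at this
      rw [mul_one, ← h4, ← map_pi_comp_injective e.injective, lintegral_map hG (by fun_prop)]
    · simp
  rw [h2]
  simp only [div_eq_mul_inv]
  rw [lintegral_mul_const _ (Finset.measurable_sum _ fun e _ => hGm e),
    lintegral_finsetSum _ fun e _ => hGm e, Finset.sum_congr rfl fun e _ => h3 e,
    ← Finset.mul_sum, mul_assoc]
  have h5 : (∑ e : Fin n ↪ Fin z ⊕ Fin m, if ∀ a, (e a).isLeft then (1 : ENNReal) else 0) ≠ ⊤ := by
    rw [Finset.sum_boole]; exact ENNReal.natCast_ne_top _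
  split_ifs with hnz
  · rw [ENNReal.mul_inv_cancel _ h5, mul_one]
    rw [Finset.sum_boole]
    have : (Fin.castLEEmb hnz).trans ⟨Sum.inl, Sum.inl_injective⟩ ∈
      Finset.univ.filter (fun e : Fin n ↪ Fin z ⊕ Fin m => ∀ a, (e a).isLeft) := by
      simp
    exact_mod_cast Finset.card_ne_zero_of_mem this
  · have : ∀ e : Fin n ↪ Fin z ⊕ Fin m, ¬ ∀ a, (e a).isLeft := by
      intro e he
      apply hnz
      have := Fintype.card_le_of_injective (fun a => (e a).getLeft (he a)) (fun a b hab => by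
        have h := congrArg (Sum.inl (β := Fin m)) hab
        simp only [Sum.inl_getLeft] at h
        exact e.injective h)
      simpa using this
    simp [this]

end

/-! ### The Poisson process of arrivals -/

lemma lintegral_iidLaw {α : Type*} [MeasurableSpace α] (ν : Measure α) [IsProbabilityMeasure ν]
    {f : (ℕ → α) → ENNReal} (hf : Measurable f) :
    ∫⁻ V, f V ∂iidLaw ν = ∫⁻ x, ∫⁻ V, f (seqCons x V) ∂iidLaw ν ∂ν := by
  rw [← (measurePreserving_seqCons (fun _ : ℕ => ν)).lintegral_comp hf]
  exact lintegral_prod _ (hf.comp measurable_seqCons).aemeasurable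

lemma lintegral_expMeasure {r : ℝ} {f : ℝ → ENNReal} (hf : Measurable f) :
    ∫⁻ u, f u ∂expMeasure r =
      ∫⁻ u in Set.Ioi 0, ENNReal.ofReal (r * Real.exp (-(r * u))) * f u := by
  have hm : Measurable (gammaPDF 1 r) := (measurable_gammaPDFReal 1 r).ennreal_ofReal
  rw [expMeasure, gammaMeasure, lintegral_withDensity_eq_lintegral_mul _ hm hf,
    ← lintegral_indicator measurableSet_Ioi]
  refine lintegral_congr_ae ?_
  have h0 : ∀ᵐ u : ℝ, u ≠ 0 := by simp [ae_iff]
  filter_upwards [h0] with u hu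
  change exponentialPDF r u * f u = _
  by_cases h : 0 < u
  · rw [Set.indicator_of_mem (Set.mem_Ioi.2 h), exponentialPDF_of_nonneg h.le]
  · rw [Set.indicator_of_notMem (by simpa using h),
      exponentialPDF_of_neg (lt_of_le_of_ne (not_lt.1 h) hu), zero_mul]

/-- Exactly the events `0, …, m - 1` of the counting process with inter-event times `U` occur up to
time `h`, if the inter-event times are non-negative. -/
def ArrivedUpTo (m : ℕ) (h : ℝ) (U : ℕ → ℝ) : Prop :=
  (∀ k < m, eventTime U k ≤ h) ∧ h < eventTime U m

/-- The inter-event times as seen from time `h`, after the first `m` events. -/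
def interEventAfter (m : ℕ) (h : ℝ) (U : ℕ → ℝ) : ℕ → ℝ :=
  seqCons (eventTime U m - h) (fun k => U (m + k + 1))

lemma eventTime_interEventAfter (m : ℕ) (h : ℝ) (U : ℕ → ℝ) (k : ℕ) :
    eventTime (interEventAfter m h U) k = eventTime U (m + k) - h := by
  cases k with
  | zero => simp [interEventAfter, eventTime_seqCons_zero]
  | succ k =>
    rw [interEventAfter, eventTime_seqCons_succ]
    simp only [eventTime]
    rw [show m + (k + 1) + 1 = (m + 1) + (k + 1) by ring, Finset.sum_range_add _ (m + 1)]
    simp only [show ∀ x, m + x + 1 = m + 1 + x from fun x => by ring]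
    ring

lemma measurableSet_arrivedUpTo (m : ℕ) (h : ℝ) : MeasurableSet {U | ArrivedUpTo m h U} := by
  simp only [ArrivedUpTo, Set.ofPred_and, Set.ofPred_forall]
  refine MeasurableSet.inter (MeasurableSet.iInter fun k => MeasurableSet.iInter fun _ => ?_) ?_
  · exact measurableSet_le (measurable_eventTime k) measurable_const
  · exact measurableSet_lt measurable_const (measurable_eventTime m)

lemma measurable_interEventAfter (m : ℕ) (h : ℝ) : Measurable (interEventAfter m h) :=
  measurable_seqCons.comp (((measurable_eventTime m).sub_const h).prodMk (by fun_prop))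

lemma arrivedUpTo_zero (h u : ℝ) (V : ℕ → ℝ) : ArrivedUpTo 0 h (seqCons u V) ↔ h < u := by
  simp [ArrivedUpTo, eventTime_seqCons_zero]

lemma arrivedUpTo_succ (m : ℕ) (h u : ℝ) (V : ℕ → ℝ) :
    ArrivedUpTo (m + 1) h (seqCons u V) ↔ u ≤ h ∧ ArrivedUpTo m (h - u) V := by
  simp only [ArrivedUpTo, eventTime_seqCons_succ]
  constructor
  · rintro ⟨h1, h2⟩
    refine ⟨by simpa [eventTime_seqCons_zero] using h1 0 (Nat.succ_pos _), fun k hk => ?_,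
      by linarith⟩
    have := h1 (k + 1) (Nat.succ_lt_succ hk)
    rw [eventTime_seqCons_succ] at this
    linarith
  · rintro ⟨h1, h2, h3⟩
    refine ⟨fun k hk => ?_, by linarith⟩
    cases k with
    | zero => rwa [eventTime_seqCons_zero]
    | succ k =>
      rw [eventTime_seqCons_succ]
      have := h2 k (Nat.lt_of_succ_lt_succ hk)
      linarith

lemma interEventAfter_zero (h u : ℝ) (V : ℕ → ℝ) :
    interEventAfter 0 h (seqCons u V) = seqCons (u - h) V := by
  simp [interEventAfter, eventTime_seqCons_zero]

lemma interEventAfter_succ (m : ℕ) (h u : ℝ) (V : ℕ → ℝ) :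
    interEventAfter (m + 1) h (seqCons u V) = interEventAfter m (h - u) V := by
  simp only [interEventAfter, eventTime_seqCons_succ]
  congr 1
  · ring
  · funext k
    rw [show m + 1 + k + 1 = (m + k + 1) + 1 by ring, seqCons_succ]

/-- The vectors of marked ages that occur for `m` arrivals in `(0, h]`: the ages decrease in the
order of arrival and are less than `h`. -/
def decreasingAges (m : ℕ) (h : ℝ) : Set (Fin m → ℝ × ℝ) :=
  {w | StrictAnti (fun k => (w k).1) ∧ ∀ k, (w k).1 < h}

lemma measurableSet_decreasingAges (m : ℕ) (h : ℝ) : MeasurableSet (decreasingAges m h) := by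
  simp only [decreasingAges, StrictAnti, Set.ofPred_and, Set.ofPred_forall]
  refine MeasurableSet.inter (MeasurableSet.iInter fun k => MeasurableSet.iInter fun l =>
    MeasurableSet.iInter fun _ => ?_) (MeasurableSet.iInter fun k => ?_)
  · exact measurableSet_lt (by fun_prop) (by fun_prop)
  · exact measurableSet_lt (by fun_prop) (by fun_prop)

lemma cons_mem_decreasingAges (m : ℕ) (h : ℝ) (a : ℝ × ℝ) (w : Fin m → ℝ × ℝ) :
    Fin.cons (α := fun _ => ℝ × ℝ) a w ∈ decreasingAges (m + 1) h ↔
      a.1 < h ∧ w ∈ decreasingAges m a.1 := by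
  simp only [decreasingAges, Set.mem_ofPred_eq]
  constructor
  · rintro ⟨h1, h2⟩
    refine ⟨by simpa using h2 0, fun k l hkl => ?_, fun k => ?_⟩
    · simpa using h1 (Fin.succ_lt_succ_iff.2 hkl)
    · simpa using h1 (Fin.succ_pos k)
  · rintro ⟨h1, h2, h3⟩
    refine ⟨fun k l hkl => ?_, fun k => ?_⟩
    · cases l using Fin.cases with
      | zero => exact absurd hkl (Fin.not_lt_zero _)
      | succ l =>
        cases k using Fin.cases with
        | zero => simpa using h3 l
        | succ k => simpa using h2 (Fin.succ_lt_succ_iff.1 hkl)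
    · cases k using Fin.cases with
      | zero => simpa using h1
      | succ k => simpa using (h3 k).trans h1

/-- The reference measure for the age and the processing time of an arrival. -/
abbrev ageMeasure (ν : Measure ℝ) : Measure (ℝ × ℝ) := (volume.restrict (Set.Ici 0)).prod ν

open Classical in
/-- The ages of the arrivals up to time `h` have a density with respect to Lebesgue measure, and
after time `h` the arrivals and processing times start afresh. -/
lemma lintegral_arrivedUpTo {r : ℝ} (hr : 0 < r) [IsProbabilityMeasure (expMeasure r)]
    (ν : Measure ℝ) [IsProbabilityMeasure ν] (m : ℕ) :
    ∀ (h : ℝ), 0 ≤ h → ∀ F : (Fin m → ℝ × ℝ) × (ℕ → ℝ) × (ℕ → ℝ) → ENNReal, Measurable F →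
      ∫⁻ U, ∫⁻ S, (if ArrivedUpTo m h U then F (fun k => (h - eventTime U k, S k),
          interEventAfter m h U, fun k => S (m + k)) else 0) ∂iidLaw ν ∂iidLaw (expMeasure r) =
        ENNReal.ofReal (r ^ m * Real.exp (-(r * h))) *
          ∫⁻ w in decreasingAges m h, (∫⁻ U, ∫⁻ S, F (w, U, S) ∂iidLaw ν ∂iidLaw (expMeasure r))
            ∂Measure.pi (fun _ => ageMeasure ν) := by
  induction m with
  | zero =>
    intro h hh F hF
    have hD : decreasingAges 0 h = Set.univ :=
      Set.eq_univ_of_forall fun w => ⟨fun k => k.elim0, fun k => k.elim0⟩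
    have hF' : ∀ w, Measurable fun U => ∫⁻ S, F (w, U, S) ∂iidLaw ν := fun w =>
      Measurable.lintegral_prod_right' (f := fun q : (ℕ → ℝ) × (ℕ → ℝ) => F (w, q.1, q.2))
        (hF.comp (by fun_prop))
    set G : ℝ → ENNReal := fun u => ∫⁻ V, ∫⁻ S, F (Fin.elim0, seqCons u V, S) ∂iidLaw ν
      ∂iidLaw (expMeasure r) with hG
    have hGm : Measurable G :=
      Measurable.lintegral_prod_right' (f := fun q : ℝ × (ℕ → ℝ) =>
        ∫⁻ S, F (Fin.elim0, seqCons q.1 q.2, S) ∂iidLaw ν) ((hF' _).comp measurable_seqCons)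
    have hw : ∀ w : Fin 0 → ℝ × ℝ, w = Fin.elim0 := fun w => Subsingleton.elim _ _
    have hL : Measurable fun U : ℕ → ℝ => ∫⁻ S, (if ArrivedUpTo 0 h U then
        F (fun k => (h - eventTime U k, S k), interEventAfter 0 h U, fun k => S (0 + k)) else 0)
        ∂iidLaw ν := by
      simp only [hw, zero_add]
      refine Measurable.lintegral_prod_right' (f := fun q : (ℕ → ℝ) × (ℕ → ℝ) =>
        if ArrivedUpTo 0 h q.1 then F (Fin.elim0, interEventAfter 0 h q.1, q.2) else 0) ?_
      refine Measurable.ite (measurable_fst (measurableSet_arrivedUpTo 0 h)) ?_ measurable_const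
      exact hF.comp (measurable_const.prodMk
        (((measurable_interEventAfter 0 h).comp measurable_fst).prodMk measurable_snd))
    rw [lintegral_iidLaw _ hL, hD, Measure.restrict_univ]
    simp only [hw, zero_add, arrivedUpTo_zero, interEventAfter_zero]
    have h1 : ∀ u : ℝ, (∫⁻ V, ∫⁻ S, (if h < u then F (Fin.elim0, seqCons (u - h) V, S) else 0)
        ∂iidLaw ν ∂iidLaw (expMeasure r)) = if h < u then G (u - h) else 0 := by
      intro u
      split_ifs <;> simp [hG]
    simp only [h1]
    rw [lintegral_expMeasure (Measurable.ite measurableSet_Ioi (by fun_prop) measurable_const),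
      Measure.pi_of_empty, lintegral_dirac, lintegral_iidLaw _ (hF' _)]
    change _ = _ * ∫⁻ u, G u ∂expMeasure r
    rw [lintegral_expMeasure hGm, ← lintegral_const_mul _ (by fun_prop),
      ← lintegral_indicator measurableSet_Ioi, ← lintegral_indicator measurableSet_Ioi]
    conv_rhs => rw [← lintegral_sub_right_eq_self _ h]
    refine lintegral_congr fun u => ?_
    by_cases hu : h < u
    · rw [Set.indicator_of_mem (Set.mem_Ioi.2 (hh.trans_lt hu)),
        Set.indicator_of_mem (Set.mem_Ioi.2 (sub_pos.2 hu)), if_pos hu, ← mul_assoc,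
        ← ENNReal.ofReal_mul (by positivity)]
      congr 2
      rw [pow_zero, one_mul, mul_left_comm, ← Real.exp_add]
      congr 2; ring
    · rw [Set.indicator_of_notMem (a := u - h) (by simpa using hu)]
      simp [Set.indicator_apply, hu]
  | succ m ih =>
    intro h hh F hF
    set μ := iidLaw (expMeasure r) with hμ
    set K : ℝ × ℝ → ENNReal := fun a => ∫⁻ w in decreasingAges m a.1,
      (∫⁻ U, ∫⁻ S, F (Fin.cons (α := fun _ => ℝ × ℝ) a w, U, S) ∂iidLaw ν ∂μ)
        ∂Measure.pi (fun _ => ageMeasure ν) with hK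
    have hcons : Measurable fun q : (ℝ × ℝ) × (Fin m → ℝ × ℝ) =>
        Fin.cons (α := fun _ => ℝ × ℝ) q.1 q.2 := by
      refine measurable_pi_iff.2 fun k => ?_
      cases k using Fin.cases with
      | zero => simpa using measurable_fst
      | succ k => simp only [Fin.cons_succ]; fun_prop
    have hF1 : Measurable fun w : Fin (m + 1) → ℝ × ℝ => ∫⁻ U, ∫⁻ S, F (w, U, S) ∂iidLaw ν ∂μ := by
      refine Measurable.lintegral_prod_right' (f := fun q : (Fin (m + 1) → ℝ × ℝ) × (ℕ → ℝ) =>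
        ∫⁻ S, F (q.1, q.2, S) ∂iidLaw ν) ?_
      exact Measurable.lintegral_prod_right' (f := fun q : ((Fin (m + 1) → ℝ × ℝ) × (ℕ → ℝ)) ×
        (ℕ → ℝ) => F (q.1.1, q.1.2, q.2)) (hF.comp (by fun_prop))
    have hKm : Measurable K := by
      have : K = fun a => ∫⁻ w, (if w ∈ decreasingAges m a.1 then
          ∫⁻ U, ∫⁻ S, F (Fin.cons (α := fun _ => ℝ × ℝ) a w, U, S) ∂iidLaw ν ∂μ else 0)
          ∂Measure.pi (fun _ => ageMeasure ν) := by
        funext a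
        simp only [hK]
        rw [← lintegral_indicator (measurableSet_decreasingAges m a.1)]
        rfl
      rw [this]
      refine Measurable.lintegral_prod_right' (f := fun q : (ℝ × ℝ) × (Fin m → ℝ × ℝ) =>
        if q.2 ∈ decreasingAges m q.1.1 then
          ∫⁻ U, ∫⁻ S, F (Fin.cons (α := fun _ => ℝ × ℝ) q.1 q.2, U, S) ∂iidLaw ν ∂μ else 0) ?_
      refine Measurable.ite ?_ (hF1.comp hcons) measurable_const
      have h1 : MeasurableSet {q : (ℝ × ℝ) × (Fin m → ℝ × ℝ) | StrictAnti fun k => (q.2 k).1} := by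
        simp only [StrictAnti, Set.ofPred_forall]
        exact MeasurableSet.iInter fun k => MeasurableSet.iInter fun l =>
          MeasurableSet.iInter fun _ => measurableSet_lt (by fun_prop) (by fun_prop)
      have h2 : MeasurableSet {q : (ℝ × ℝ) × (Fin m → ℝ × ℝ) | ∀ k, (q.2 k).1 < q.1.1} := by
        simp only [Set.ofPred_forall]
        exact MeasurableSet.iInter fun k => measurableSet_lt (by fun_prop) (by fun_prop)
      exact h1.inter h2
    -- The integrand on the left-hand side, as a function of both sequences.
    set H : (ℕ → ℝ) × (ℕ → ℝ) → ENNReal := fun q => if ArrivedUpTo (m + 1) h q.1 then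
      F (fun k => (h - eventTime q.1 k, q.2 k), interEventAfter (m + 1) h q.1,
        fun k => q.2 (m + 1 + k)) else 0 with hH
    have hHm : Measurable H := by
      refine Measurable.ite (measurable_fst (measurableSet_arrivedUpTo (m + 1) h)) ?_
        measurable_const
      refine hF.comp (Measurable.prodMk ?_ (Measurable.prodMk ?_ (by fun_prop)))
      · refine measurable_pi_iff.2 fun k => Measurable.prodMk ?_ (by fun_prop)
        exact ((measurable_eventTime k).comp measurable_fst).const_sub h
      · exact (measurable_interEventAfter (m + 1) h).comp measurable_fst
    have hstep : ∀ u s : ℝ, (∫⁻ V, ∫⁻ S, H (seqCons u V, seqCons s S) ∂iidLaw ν ∂μ) =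
        if u ≤ h then ENNReal.ofReal (r ^ m * Real.exp (-(r * (h - u)))) * K (h - u, s) else 0 := by
      intro u s
      by_cases hu : u ≤ h
      · have := ih (h - u) (sub_nonneg.2 hu)
          (fun q => F (Fin.cons (α := fun _ => ℝ × ℝ) (h - u, s) q.1, q.2))
          (hF.comp ((hcons.comp (measurable_const.prodMk measurable_fst)).prodMk measurable_snd))
        rw [if_pos hu, hK]
        refine Eq.trans (lintegral_congr fun V => lintegral_congr fun S => ?_) this
        simp only [hH, arrivedUpTo_succ, hu, true_and, interEventAfter_succ]
        congr 2
        refine Prod.ext (funext fun k => ?_) (Prod.ext rfl (funext fun k => ?_))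
        · cases k using Fin.cases with
          | zero => simp [eventTime_seqCons_zero]
          | succ k =>
            simp only [Fin.val_succ, eventTime_seqCons_succ, seqCons_succ, Fin.cons_succ]
            congr 1; ring
        · simp only
          rw [show m + 1 + k = (m + k) + 1 by ring, seqCons_succ]
      · simp [hH, arrivedUpTo_succ, hu]
    have hleft : ∫⁻ U, ∫⁻ S, H (U, S) ∂iidLaw ν ∂μ = ∫⁻ u, ∫⁻ s, (if u ≤ h then
        ENNReal.ofReal (r ^ m * Real.exp (-(r * (h - u)))) * K (h - u, s) else 0) ∂ν
          ∂expMeasure r := by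
      rw [hμ, lintegral_iidLaw _ hHm.lintegral_prod_right']
      refine lintegral_congr fun u => ?_
      have e1 : ∀ V : ℕ → ℝ, ∫⁻ S, H (seqCons u V, S) ∂iidLaw ν =
          ∫⁻ s, ∫⁻ S, H (seqCons u V, seqCons s S) ∂iidLaw ν ∂ν := fun V =>
        lintegral_iidLaw ν (hHm.comp (by fun_prop))
      simp only [e1]
      rw [lintegral_lintegral_swap]
      · exact lintegral_congr fun s => hstep u s
      · refine Measurable.aemeasurable ?_
        refine Measurable.lintegral_prod_right' (f := fun q : ((ℕ → ℝ) × ℝ) × (ℕ → ℝ) =>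
          H (seqCons u q.1.1, seqCons q.1.2 q.2)) (hHm.comp (Measurable.prodMk ?_ ?_))
        · exact measurable_seqCons.comp (measurable_const.prodMk (by fun_prop))
        · exact measurable_seqCons.comp (Measurable.prodMk (by fun_prop) (by fun_prop))
    have hKs : Measurable fun v : ℝ => ∫⁻ s, K (v, s) ∂ν := hKm.lintegral_prod_right'
    -- The substitution of the age `v = h - u` for the first arrival time `u`.
    have hage : ∫⁻ u, ∫⁻ s, (if u ≤ h then
        ENNReal.ofReal (r ^ m * Real.exp (-(r * (h - u)))) * K (h - u, s) else 0) ∂ν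
          ∂expMeasure r = ENNReal.ofReal (r ^ (m + 1) * Real.exp (-(r * h))) *
        ∫⁻ v, (if v ∈ Set.Ico 0 h then ∫⁻ s, K (v, s) ∂ν else 0) := by
      have e1 : ∀ u, ∫⁻ s, (if u ≤ h then
          ENNReal.ofReal (r ^ m * Real.exp (-(r * (h - u)))) * K (h - u, s) else 0) ∂ν =
          if u ≤ h then ENNReal.ofReal (r ^ m * Real.exp (-(r * (h - u)))) *
            ∫⁻ s, K (h - u, s) ∂ν else 0 := by
        intro u
        split_ifs
        · exact lintegral_const_mul _ (hKm.comp measurable_prodMk_left)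
        · simp
      simp only [e1]
      rw [lintegral_expMeasure, ← lintegral_indicator measurableSet_Ioi,
        ← lintegral_sub_left_eq_self (fun v => if v ∈ Set.Ico 0 h then _ else _) h,
        ← lintegral_const_mul]
      · refine lintegral_congr fun u => ?_
        by_cases hu : 0 < u
        · rw [Set.indicator_of_mem (Set.mem_Ioi.2 hu)]
          by_cases hu' : u ≤ h
          · rw [if_pos hu', if_pos ⟨sub_nonneg.2 hu', by linarith⟩, ← mul_assoc,
              ← ENNReal.ofReal_mul (by positivity)]
            congr 2
            rw [show r * Real.exp (-(r * u)) * (r ^ m * Real.exp (-(r * (h - u)))) =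
              r ^ (m + 1) * (Real.exp (-(r * u)) * Real.exp (-(r * (h - u)))) by ring,
              ← Real.exp_add]
            congr 2; ring
          · rw [if_neg hu', if_neg (fun hx => hu' (sub_nonneg.1 hx.1)), mul_zero, mul_zero]
        · rw [Set.indicator_of_notMem (by simpa using hu),
            if_neg (fun hx => hu (by have := hx.2; linarith)), mul_zero]
      · exact Measurable.ite (measurableSet_preimage (by fun_prop) measurableSet_Ico)
          (hKs.comp (by fun_prop)) measurable_const
      · exact Measurable.ite measurableSet_Iic (Measurable.mul (by fun_prop)
          (hKs.comp (by fun_prop))) measurable_const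
    have hright : ∫⁻ w in decreasingAges (m + 1) h, (∫⁻ U, ∫⁻ S, F (w, U, S) ∂iidLaw ν ∂μ)
        ∂Measure.pi (fun _ => ageMeasure ν) =
        ∫⁻ v, (if v ∈ Set.Ico 0 h then ∫⁻ s, K (v, s) ∂ν else 0) := by
      have hmp := (measurePreserving_piFinSuccAbove (fun _ : Fin (m + 1) => ageMeasure ν) 0).symm
      have hind : Measurable ((decreasingAges (m + 1) h).indicator fun w =>
          ∫⁻ U, ∫⁻ S, F (w, U, S) ∂iidLaw ν ∂μ) :=
        hF1.indicator (measurableSet_decreasingAges (m + 1) h)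
      rw [← lintegral_indicator (measurableSet_decreasingAges (m + 1) h),
        ← hmp.lintegral_comp hind]
      refine (lintegral_prod _ (hind.comp hmp.measurable).aemeasurable).trans ?_
      have e1 : ∀ a : ℝ × ℝ, ∫⁻ w, (decreasingAges (m + 1) h).indicator (fun w =>
          ∫⁻ U, ∫⁻ S, F (w, U, S) ∂iidLaw ν ∂μ)
          ((MeasurableEquiv.piFinSuccAbove (fun _ => ℝ × ℝ) 0).symm (a, w))
            ∂Measure.pi (fun _ => ageMeasure ν) = if a.1 < h then K a else 0 := by
        intro a
        have e2 : ∀ w : Fin m → ℝ × ℝ, (MeasurableEquiv.piFinSuccAbove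
            (fun _ : Fin (m + 1) => ℝ × ℝ) 0).symm (a, w) =
            Fin.cons (α := fun _ => ℝ × ℝ) a w := fun w => by
          simp [MeasurableEquiv.piFinSuccAbove, Fin.insertNthEquiv]
        simp only [e2]
        by_cases ha : a.1 < h
        · rw [if_pos ha]
          simp only [hK]
          rw [← lintegral_indicator (measurableSet_decreasingAges m a.1)]
          refine lintegral_congr fun w => ?_
          simp only [Set.indicator_apply, cons_mem_decreasingAges, ha, true_and]
        · rw [if_neg ha]
          simp only [Set.indicator_apply, cons_mem_decreasingAges, ha, false_and, if_false,
            lintegral_zero]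
      refine (lintegral_congr fun a => e1 a).trans ?_
      rw [lintegral_prod _ (Measurable.ite (measurableSet_lt (by fun_prop) (by fun_prop)) hKm
        measurable_const).aemeasurable, ← lintegral_indicator measurableSet_Ici]
      refine lintegral_congr fun v => ?_
      by_cases hv : 0 ≤ v <;> by_cases hv' : v < h <;> simp [hv, hv']
    rw [hright, ← hage, ← hleft]

lemma ae_injective_fst (μ : Measure (ℝ × ℝ)) [SigmaFinite μ] (hμ : ∀ c, μ {p | p.1 = c} = 0)
    (m : ℕ) : ∀ᵐ w ∂Measure.pi (fun _ : Fin m => μ), Function.Injective fun k => (w k).1 := by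
  have h : ∀ i j : Fin m, i ≠ j → ∀ᵐ w ∂Measure.pi (fun _ : Fin m => μ), (w i).1 ≠ (w j).1 := by
    intro i j hij
    obtain ⟨m, rfl⟩ : ∃ l, m = l + 1 := ⟨m - 1, by have := i.pos; omega⟩
    obtain ⟨l, rfl⟩ := Fin.exists_succAbove_eq hij.symm
    have hmp := measurePreserving_piFinSuccAbove (fun _ : Fin (m + 1) => μ) i
    have hs : MeasurableSet {q : (ℝ × ℝ) × (Fin m → ℝ × ℝ) | q.1.1 = (q.2 l).1} :=
      measurableSet_eq_fun (by fun_prop) (by fun_prop)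
    have h0 : (μ.prod (Measure.pi fun _ : Fin m => μ)) {q | q.1.1 = (q.2 l).1} = 0 := by
      rw [Measure.prod_apply_symm hs]
      exact (lintegral_congr fun y : Fin m → ℝ × ℝ => hμ (y l).1).trans lintegral_zero
    rw [ae_iff]
    simp only [not_not]
    rw [← hmp.measure_preimage hs.nullMeasurableSet] at h0
    exact h0
  have h' : ∀ᵐ w ∂Measure.pi (fun _ : Fin m => μ), ∀ i j, i ≠ j → (w i).1 ≠ (w j).1 := by
    simp only [ae_all_iff]
    exact h
  filter_upwards [h'] with w hw i j hij
  by_contra hne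
  exact hw i j hne hij

lemma existsUnique_perm_strictAnti {m : ℕ} {f : Fin m → ℝ} (hf : Function.Injective f) :
    ∃! σ : Equiv.Perm (Fin m), StrictAnti (f ∘ σ) := by
  have hsort := Tuple.monotone_sort (fun k => - f k)
  set σ := Tuple.sort (fun k => - f k)
  refine ⟨σ, fun i j hij => ?_, fun τ hτ => ?_⟩
  · have h1 := hsort hij.le
    refine lt_of_le_of_ne (neg_le_neg_iff.1 h1) fun h => hij.ne' (σ.injective (hf h))
  · have h1 : StrictMono ((fun k => - f k) ∘ τ) := fun i j hij => neg_lt_neg (hτ hij)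
    have h2 : StrictMono ((fun k => - f k) ∘ σ) :=
      hsort.strictMono_of_injective ((neg_injective.comp hf).comp σ.injective)
    have h3 := (h1.range_inj h2).1 (by
      rw [τ.surjective.range_comp, σ.surjective.range_comp])
    ext i
    exact congrArg Fin.val ((neg_injective.comp hf) (congrFun h3 i))

/-- Forgetting the order: a symmetric functional of the marked ages may be integrated over all
vectors of ages in `[0, h)` instead of the decreasing ones, at the price of a factor `1 / m!`. -/
lemma setLIntegral_decreasingAges (ν : Measure ℝ) [IsProbabilityMeasure ν] (m : ℕ) (h : ℝ)
    {F : (Fin m → ℝ × ℝ) → ENNReal} (hF : Measurable F)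
    (hsymm : ∀ (σ : Equiv.Perm (Fin m)) w, F (fun k => w (σ k)) = F w) :
    ∫⁻ w in decreasingAges m h, F w ∂Measure.pi (fun _ => ageMeasure ν) =
      (m.factorial : ENNReal)⁻¹ *
        ∫⁻ w, F w ∂Measure.pi (fun _ : Fin m => (volume.restrict (Set.Ico 0 h)).prod ν) := by
  set μ : Measure (ℝ × ℝ) := (volume.restrict (Set.Ico 0 h)).prod ν with hμ
  set A : Set (Fin m → ℝ × ℝ) := {w | StrictAnti fun k => (w k).1} with hA
  have hAm : MeasurableSet A := by
    simp only [hA, StrictAnti, Set.ofPred_forall]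
    exact MeasurableSet.iInter fun k => MeasurableSet.iInter fun l =>
      MeasurableSet.iInter fun _ => measurableSet_lt (by fun_prop) (by fun_prop)
  have h1 : ∫⁻ w in decreasingAges m h, F w ∂Measure.pi (fun _ => ageMeasure ν) =
      ∫⁻ w in A, F w ∂Measure.pi (fun _ : Fin m => μ) := by
    have e1 : decreasingAges m h = A ∩ Set.pi Set.univ (fun _ => Set.Iio h ×ˢ Set.univ) := by
      ext w; simp [decreasingAges, hA]
    have e2 : (ageMeasure ν).restrict (Set.Iio h ×ˢ Set.univ) = μ := by
      rw [← Measure.prod_restrict, Measure.restrict_restrict measurableSet_Iio,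
        Measure.restrict_univ, hμ, Set.inter_comm, Set.Ici_inter_Iio]
    rw [e1, ← Measure.restrict_restrict hAm, Measure.restrict_pi_pi, e2]
  have hnull : ∀ c, μ {p | p.1 = c} = 0 := by
    intro c
    have : {p : ℝ × ℝ | p.1 = c} = {c} ×ˢ Set.univ := by ext p; simp
    rw [this, hμ, Measure.prod_prod]
    simp
  have hperm : ∀ σ : Equiv.Perm (Fin m), ∫⁻ w in A, F w ∂Measure.pi (fun _ : Fin m => μ) =
      ∫⁻ w, A.indicator F (fun k => w (σ k)) ∂Measure.pi (fun _ : Fin m => μ) := by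
    intro σ
    rw [← lintegral_indicator hAm]
    exact (lintegral_pi_comp_equiv σ.symm (fun _ => μ) (A.indicator F)).symm
  have hsum : ∫⁻ w, F w ∂Measure.pi (fun _ : Fin m => μ) =
      ∑ σ : Equiv.Perm (Fin m), ∫⁻ w, A.indicator F (fun k => w (σ k))
        ∂Measure.pi (fun _ : Fin m => μ) := by
    rw [← lintegral_finsetSum]
    · refine lintegral_congr_ae ?_
      filter_upwards [ae_injective_fst μ hnull m] with w hw
      obtain ⟨σ, hσ, huniq⟩ := existsUnique_perm_strictAnti hw
      rw [Finset.sum_eq_single σ]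
      · rw [Set.indicator_of_mem (show (fun k => w (σ k)) ∈ A from hσ), hsymm]
      · intro τ _ hτ
        exact Set.indicator_of_notMem (fun hmem => hτ (huniq τ hmem)) _
      · simp
    · intro σ _
      exact (hF.indicator hAm).comp (by fun_prop)
  rw [h1, hsum, ← Finset.sum_congr rfl fun σ _ => hperm σ, Finset.sum_const, Finset.card_univ,
    Fintype.card_perm, Fintype.card_fin, nsmul_eq_mul, ← mul_assoc, ENNReal.inv_mul_cancel,
    one_mul]
  · exact_mod_cast m.factorial_ne_zero
  · exact ENNReal.natCast_ne_top _

/-! ### Residual life distributions -/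

lemma residualLife_Iic (ν : Measure ℝ) : residualLife ν (Set.Iic 0) = 0 := by
  refine withDensity_absolutelyContinuous _ _ ?_
  rw [Measure.restrict_apply measurableSet_Iic, Set.Iic_inter_Ioi, Set.Ioc_self, measure_empty]

/-- The residual life distribution averages, over the total length `s` of a renewal interval, the
Lebesgue measure on `(0, s)`. -/
lemma residualLife_apply {ν : Measure ℝ} [IsProbabilityMeasure ν] {μS : ℝ} (hμS : 0 < μS)
    (hν_mean : ∫ x, x ∂ν = μS⁻¹) {B : Set ℝ} (hB : MeasurableSet B) :
    residualLife ν B = ENNReal.ofReal μS * ∫⁻ s, volume (B ∩ Set.Ioo 0 s) ∂ν := by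
  have hset : MeasurableSet {q : ℝ × ℝ | q.1 ∈ B ∩ Set.Ioo 0 q.2} := by
    refine (measurable_fst hB).inter (MeasurableSet.inter ?_ ?_)
    · exact measurableSet_lt measurable_const measurable_fst
    · exact measurableSet_lt measurable_fst measurable_snd
  have h1 := Measure.prod_apply (μ := volume) (ν := ν) hset
  rw [Measure.prod_apply_symm hset] at h1
  rw [residualLife, withDensity_apply _ hB, Measure.restrict_restrict hB,
    ← lintegral_indicator (hB.inter measurableSet_Ioi)]
  have e1 : (∫⁻ s, volume (B ∩ Set.Ioo 0 s) ∂ν) = ∫⁻ y, volume ((fun x => (x, y)) ⁻¹'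
    {q : ℝ × ℝ | q.1 ∈ B ∩ Set.Ioo 0 q.2}) ∂ν := rfl
  have hmeas : Measurable fun y => ν (Prod.mk y ⁻¹' {q : ℝ × ℝ | q.1 ∈ B ∩ Set.Ioo 0 q.2}) :=
    measurable_measure_prodMk_left hset
  rw [e1, h1, ← lintegral_const_mul _ hmeas]
  refine lintegral_congr fun y => ?_
  by_cases hy : y ∈ B ∩ Set.Ioi 0
  · have : Prod.mk y ⁻¹' {q : ℝ × ℝ | q.1 ∈ B ∩ Set.Ioo 0 q.2} = Set.Ioi y := by
      ext s; simpa [hy.1] using fun _ => hy.2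
    rw [Set.indicator_of_mem hy, this, hν_mean, div_inv_eq_mul, mul_comm,
      ENNReal.ofReal_mul hμS.le, ofReal_measureReal]
  · have : Prod.mk y ⁻¹' {q : ℝ × ℝ | q.1 ∈ B ∩ Set.Ioo 0 q.2} = ∅ := by
      ext s
      simp only [Set.mem_preimage, Set.mem_ofPred_eq, Set.mem_empty_iff_false, iff_false]
      exact fun hs => hy ⟨hs.1, hs.2.1⟩
    rw [Set.indicator_of_notMem hy, this, measure_empty, mul_zero]

lemma residualLife_expMeasure {r : ℝ} (hr : 0 < r) :
    residualLife (expMeasure r) = expMeasure r := by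
  have := isProbabilityMeasure_expMeasure hr
  have htail : ∀ y : ℝ, 0 < y → (expMeasure r).real (Set.Ioi y) = Real.exp (-(r * y)) := by
    intro y hy
    have h1 := cdf_expMeasure_eq hr y
    rw [cdf_eq_real, if_pos hy.le] at h1
    rw [← Set.compl_Iic, probReal_compl_eq_one_sub measurableSet_Iic, h1]
    ring
  have hmean : ∫ x, x ∂expMeasure r = r⁻¹ := by
    have hm : Measurable (gammaPDF 1 r) := (measurable_gammaPDFReal 1 r).ennreal_ofReal
    rw [expMeasure, gammaMeasure, integral_withDensity_eq_integral_toReal_smul hm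
      (by simp [gammaPDF])]
    have h1 : ∀ x : ℝ, (gammaPDF 1 r x).toReal • x =
        (Set.Ioi 0).indicator (fun x => r * (x ^ ((2 : ℝ) - 1) * Real.exp (-(r * x)))) x := by
      intro x
      rcases lt_trichotomy x 0 with h | rfl | h
      · rw [gammaPDF_of_neg h, Set.indicator_of_notMem (by simpa using h.le)]; simp
      · simp
      · have h2 : gammaPDF 1 r x = ENNReal.ofReal (r * Real.exp (-(r * x))) :=
          exponentialPDF_of_nonneg h.le
        rw [h2, Set.indicator_of_mem (Set.mem_Ioi.2 h), ENNReal.toReal_ofReal (by positivity),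
          show (2 : ℝ) - 1 = 1 by norm_num, Real.rpow_one, smul_eq_mul]
        ring
    simp only [h1]
    rw [integral_indicator measurableSet_Ioi, integral_const_mul,
      Real.integral_rpow_mul_exp_neg_mul_Ioi two_pos hr, Real.Gamma_two]
    rw [show (2 : ℝ) = ((2 : ℕ) : ℝ) by norm_num, Real.rpow_natCast]
    field_simp
  ext B hB
  rw [residualLife, withDensity_apply _ hB, expMeasure, gammaMeasure, withDensity_apply _ hB,
    Measure.restrict_restrict hB, ← lintegral_indicator hB,
    ← lintegral_indicator (hB.inter measurableSet_Ioi)]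
  refine lintegral_congr_ae ?_
  have h0 : ∀ᵐ u : ℝ, u ≠ 0 := by simp [ae_iff]
  filter_upwards [h0] with u hu
  by_cases hB' : u ∈ B
  · rw [Set.indicator_of_mem hB']
    change _ = exponentialPDF r u
    by_cases h : 0 < u
    · rw [Set.indicator_of_mem (show u ∈ B ∩ Set.Ioi 0 from ⟨hB', h⟩),
        exponentialPDF_of_nonneg h.le]
      change ENNReal.ofReal ((expMeasure r).real (Set.Ioi u) / ∫ x, x ∂expMeasure r) = _
      rw [htail u h, hmean, div_inv_eq_mul, mul_comm]
    · rw [Set.indicator_of_notMem (fun hx => h hx.2),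
        exponentialPDF_of_neg (lt_of_le_of_ne (not_lt.1 h) hu)]
  · rw [Set.indicator_of_notMem hB', Set.indicator_of_notMem (fun hx => hB' hx.1)]

/-! ### Stationarity of the infinite-server system -/

/-- The distribution of the residual processing time at time `h`, after the infinite-server system
has started at time `0`, of an arrival in `(0, h]`, weighted with the length of this interval. -/
def arrivalResidual (ν : Measure ℝ) (h : ℝ) : Measure ℝ :=
  ((volume.restrict (Set.Ico 0 h)).prod ν).map fun p => p.2 - p.1

instance (ν : Measure ℝ) [IsProbabilityMeasure ν] (h : ℝ) :
    IsFiniteMeasure (arrivalResidual ν h) := by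
  unfold arrivalResidual; infer_instance

lemma arrivalResidual_univ (ν : Measure ℝ) [IsProbabilityMeasure ν] (h : ℝ) :
    arrivalResidual ν h Set.univ = ENNReal.ofReal h := by
  rw [arrivalResidual, Measure.map_apply (by fun_prop) MeasurableSet.univ, Set.preimage_univ,
    ← Set.univ_prod_univ, Measure.prod_prod]
  simp

lemma arrivalResidual_apply (ν : Measure ℝ) [IsProbabilityMeasure ν] (h : ℝ) {B : Set ℝ}
    (hB : MeasurableSet B) :
    arrivalResidual ν h B = ∫⁻ s, volume (B ∩ Set.Ioc (s - h) s) ∂ν := by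
  have hm : Measurable fun p : ℝ × ℝ => p.2 - p.1 := by fun_prop
  rw [arrivalResidual, Measure.map_apply hm hB, Measure.prod_apply_symm (hm hB)]
  refine lintegral_congr fun s => ?_
  rw [Measure.restrict_apply (measurable_prodMk_right (hm hB)),
    ← (Measure.measurePreserving_sub_left volume s).measure_preimage
      (hB.inter measurableSet_Ioc).nullMeasurableSet]
  congr 1
  ext v
  simp only [Set.mem_inter_iff, Set.mem_preimage, Set.mem_Ico, Set.mem_Ioc]
  refine and_congr_right fun _ => ⟨fun h => ⟨by linarith, by linarith⟩,
    fun h => ⟨by linarith, by linarith⟩⟩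

/-- The initial jobs that are still present at time `h`, together with the arrivals in `(0, h]` that
are, have the same intensity of residual processing times as the initial jobs at time `0`. -/
lemma restrict_residual_eq {ν : Measure ℝ} [IsProbabilityMeasure ν] {r μS h : ℝ} (hr : 0 < r)
    (hμS : 0 < μS) (hν_mean : ∫ x, x ∂ν = μS⁻¹) (hh : 0 ≤ h) :
    (ENNReal.ofReal (r / μS) • (residualLife ν).map (fun x => x - h) +
        ENNReal.ofReal r • arrivalResidual ν h).restrict (Set.Ioi 0) =
      ENNReal.ofReal (r / μS) • residualLife ν := by
  ext B hB
  have hB' : MeasurableSet (B ∩ Set.Ioi 0) := hB.inter measurableSet_Ioi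
  have hmsub : Measurable fun x : ℝ => x - h := by fun_prop
  have hc : ENNReal.ofReal (r / μS) * ENNReal.ofReal μS = ENNReal.ofReal r := by
    rw [← ENNReal.ofReal_mul (by positivity), div_mul_cancel₀ _ hμS.ne']
  have hm : ∀ C : Set ℝ, MeasurableSet C → Measurable fun s : ℝ => volume (C ∩ Set.Iio s) := by
    intro C hC
    refine measurable_measure_prodMk_left (ν := (volume : Measure ℝ))
      (s := {q : ℝ × ℝ | q.2 ∈ C ∩ Set.Iio q.1}) ?_
    exact (measurable_snd hC).inter (measurableSet_lt measurable_snd measurable_fst)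
  rw [Measure.restrict_apply hB, Measure.add_apply, Measure.smul_apply, Measure.smul_apply,
    Measure.smul_apply, Measure.map_apply hmsub hB', residualLife_apply hμS hν_mean (hmsub hB'),
    residualLife_apply hμS hν_mean hB, arrivalResidual_apply ν h hB', smul_eq_mul, smul_eq_mul,
    smul_eq_mul, ← mul_assoc, ← mul_assoc, hc, ← mul_add]
  congr 1
  have e1 : ∀ s, volume ((fun x => x - h) ⁻¹' (B ∩ Set.Ioi 0) ∩ Set.Ioo 0 s) =
      volume ((B ∩ Set.Ioi 0) ∩ Set.Iio (s - h)) := by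
    intro s
    rw [← (measurePreserving_sub_right volume h).measure_preimage
      (hB'.inter measurableSet_Iio).nullMeasurableSet]
    congr 1
    ext x
    simp only [Set.mem_inter_iff, Set.mem_preimage, Set.mem_Ioi, Set.mem_Ioo, Set.mem_Iio]
    constructor
    · rintro ⟨⟨h1, h2⟩, h3, h4⟩; exact ⟨⟨h1, h2⟩, by linarith⟩
    · rintro ⟨⟨h1, h2⟩, h3⟩; exact ⟨⟨h1, h2⟩, by linarith, by linarith⟩
  have e2 : Measurable fun s : ℝ => volume ((B ∩ Set.Ioi 0) ∩ Set.Iio (s - h)) :=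
    (hm _ hB').comp (by fun_prop)
  simp only [e1]
  rw [← lintegral_add_left e2]
  refine lintegral_congr fun s => ?_
  have e3 : volume ((B ∩ Set.Ioi 0) ∩ Set.Iio (s - h)) =
      volume ((B ∩ Set.Ioi 0) ∩ Set.Iic (s - h)) :=
    measure_congr (Filter.EventuallyEq.rfl.inter Iio_ae_eq_Iic)
  have e4 : volume (B ∩ Set.Ioo 0 s) = volume ((B ∩ Set.Ioi 0) ∩ Set.Iic s) := by
    rw [← Set.Ioi_inter_Iio, ← Set.inter_assoc]
    exact measure_congr (Filter.EventuallyEq.rfl.inter Iio_ae_eq_Iic)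
  rw [e3, e4, ← Set.Iic_union_Ioc_eq_Iic (show s - h ≤ s by linarith), Set.inter_union_distrib_left,
    measure_union _ (hB'.inter measurableSet_Ioc)]
  exact (Set.Iic_disjoint_Ioc le_rfl).mono Set.inter_subset_right Set.inter_subset_right

lemma exists_smul_probability (N : Measure ℝ) [IsFiniteMeasure N] (hN : N (Set.Ioi 0) = 0) :
    ∃ N' : Measure ℝ, IsProbabilityMeasure N' ∧ N' (Set.Ioi 0) = 0 ∧ N = N Set.univ • N' := by
  by_cases h : N = 0
  · exact ⟨Measure.dirac 0, inferInstance, by simp, by simp [h]⟩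
  · have : NeZero N := ⟨h⟩
    refine ⟨(N Set.univ)⁻¹ • N, inferInstance, by simp [hN], ?_⟩
    rw [smul_smul, ENNReal.mul_inv_cancel (by simpa using h) (measure_ne_top _ _), one_smul]

lemma tsum_pow_mul_inv_factorial {b : ℝ} (hb : 0 ≤ b) :
    ∑' m : ℕ, (m.factorial : ENNReal)⁻¹ * ENNReal.ofReal b ^ m = ENNReal.ofReal (Real.exp b) := by
  rw [Real.exp_eq_exp_ℝ, NormedSpace.exp_eq_tsum_div, ENNReal.ofReal_tsum_of_nonneg
    (fun m => by positivity) (Real.summable_pow_div_factorial b)]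
  refine tsum_congr fun m => ?_
  rw [div_eq_inv_mul, ENNReal.ofReal_mul (by positivity),
    ENNReal.ofReal_inv_of_pos (by positivity), ENNReal.ofReal_natCast, ENNReal.ofReal_pow hb]

lemma poissonMeasure_singleton_eq {b : ℝ} (hb : 0 ≤ b) (z : ℕ) :
    poissonMeasure b.toNNReal {z} =
      ENNReal.ofReal (Real.exp (-b)) * ((z.factorial : ENNReal)⁻¹ * ENNReal.ofReal b ^ z) := by
  rw [poissonMeasure_singleton, Real.coe_toNNReal _ hb, mul_div_assoc,
    ENNReal.ofReal_mul (by positivity), div_eq_inv_mul, ENNReal.ofReal_mul (by positivity),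
    ENNReal.ofReal_inv_of_pos (by positivity), ENNReal.ofReal_natCast, ENNReal.ofReal_pow hb]

lemma poissonMeasure_le_eq {b : ℝ} (hb : 0 ≤ b) (n : ℕ) :
    poissonMeasure b.toNNReal {z | n ≤ z} = ENNReal.ofReal (Real.exp (-b)) *
      ∑' z : ℕ, (z.factorial : ENNReal)⁻¹ * (ENNReal.ofReal b ^ z * if n ≤ z then 1 else 0) := by
  rw [← ENNReal.tsum_mul_left, ← lintegral_indicator_one (MeasurableSet.of_discrete),
    lintegral_countable']
  refine tsum_congr fun z => ?_
  rw [poissonMeasure_singleton_eq hb]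
  by_cases hz : n ≤ z <;> simp [hz]

lemma populationIntegral_eq_lintegral_lintegral {n : ℕ} {G : (Fin n → ℝ) → ENNReal}
    (hG : Measurable G) (M N : Measure ℝ) [IsFiniteMeasure M] [IsFiniteMeasure N] (z m : ℕ) :
    populationIntegral G M N z m = ∫⁻ x : Fin z → ℝ, ∫⁻ y : Fin m → ℝ,
      averageAlive G (Sum.elim x y) ∂Measure.pi (fun _ => N) ∂Measure.pi (fun _ => M) := by
  have hf : ∀ i : Fin z ⊕ Fin m, IsFiniteMeasure
      (Sum.elim (fun _ => M) (fun _ => N) i : Measure ℝ) := by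
    rintro (i | i) <;> simp only [Sum.elim_inl, Sum.elim_inr] <;> infer_instance
  have hmp := measurePreserving_sumPiEquivProdPi_symm (X := fun _ : Fin z ⊕ Fin m => ℝ)
    (Sum.elim (fun _ => M) (fun _ => N))
  have hA := measurable_averageAlive (ι := Fin z ⊕ Fin m) hG
  rw [populationIntegral, ← hmp.lintegral_comp hA]
  refine (lintegral_prod _ (hA.comp hmp.measurable).aemeasurable).trans ?_
  refine lintegral_congr fun x => lintegral_congr fun y => ?_
  exact congrArg (averageAlive G) (funext fun i => by rcases i with i | i <;> rfl)

section
variable {n : ℕ} {ν : Measure ℝ} [IsProbabilityMeasure ν]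

open Classical in
/-- The contribution to the average over the jobs that are present at time `h`, of `z` initial jobs
with residual processing times `x` and `m` arrivals up to time `h`. The quantity `Γ` that is
averaged depends on the residual processing times at time `h` of the chosen jobs, on the
inter-arrival times after time `h` and on the processing times of the later arrivals. -/
def averageAtTime (Γ : (Fin n → ℝ) × (ℕ → ℝ) × (ℕ → ℝ) → ENNReal) (h : ℝ) (z m : ℕ) (x : Fin z → ℝ)
    (U S : ℕ → ℝ) : ENNReal :=
  if ArrivedUpTo m h U then
    averageAlive (fun y => Γ (y, interEventAfter m h U, fun k => S (m + k)))
      (Sum.elim (fun i => x i - h) (fun k : Fin m => S k - (h - eventTime U k)))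
  else 0

lemma measurable_averageAtTime {Γ : (Fin n → ℝ) × (ℕ → ℝ) × (ℕ → ℝ) → ENNReal}
    (hΓ : Measurable Γ) (h : ℝ) (z m : ℕ) :
    Measurable fun q : (Fin z → ℝ) × (ℕ → ℝ) × (ℕ → ℝ) =>
      averageAtTime Γ h z m q.1 q.2.1 q.2.2 := by
  classical
  unfold averageAtTime
  refine Measurable.ite ((measurable_fst.comp measurable_snd) (measurableSet_arrivedUpTo m h)) ?_
    measurable_const
  refine (measurable_averageAlive_uncurry (ι := Fin z ⊕ Fin m) hΓ).comp
    (f := fun q : (Fin z → ℝ) × (ℕ → ℝ) × (ℕ → ℝ) =>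
      (Sum.elim (fun i => q.1 i - h) (fun k : Fin m => q.2.2 k - (h - eventTime q.2.1 k)),
        interEventAfter m h q.2.1, fun k => q.2.2 (m + k))) ?_
  refine Measurable.prodMk (measurable_pi_iff.2 ?_) (Measurable.prodMk ?_ (by fun_prop))
  · rintro (i | k)
    · simp only [Sum.elim_inl]; fun_prop
    · simp only [Sum.elim_inr]
      have : Measurable fun q : (Fin z → ℝ) × (ℕ → ℝ) × (ℕ → ℝ) => eventTime q.2.1 k :=
        (measurable_eventTime k).comp (by fun_prop)
      exact Measurable.sub (by fun_prop) (this.const_sub h)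
  · exact (measurable_interEventAfter m h).comp (measurable_fst.comp measurable_snd)

lemma lintegral_averageAtTime {r : ℝ} (hr : 0 < r) [IsProbabilityMeasure (expMeasure r)]
    {Γ : (Fin n → ℝ) × (ℕ → ℝ) × (ℕ → ℝ) → ENNReal} (hΓ : Measurable Γ) {h : ℝ} (hh : 0 ≤ h)
    (R : Measure ℝ) [IsProbabilityMeasure R] (z m : ℕ) :
    ∫⁻ x, ∫⁻ U, ∫⁻ S, averageAtTime Γ h z m x U S ∂iidLaw ν ∂iidLaw (expMeasure r)
        ∂Measure.pi (fun _ => R) =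
      ENNReal.ofReal (Real.exp (-(r * h))) * ((m.factorial : ENNReal)⁻¹ *
        populationIntegral (fun y => ∫⁻ U, ∫⁻ S, Γ (y, U, S) ∂iidLaw ν ∂iidLaw (expMeasure r))
          (R.map fun x => x - h) (ENNReal.ofReal r • arrivalResidual ν h) z m) := by
  classical
  set G : (Fin n → ℝ) → ENNReal :=
    fun y => ∫⁻ U, ∫⁻ S, Γ (y, U, S) ∂iidLaw ν ∂iidLaw (expMeasure r) with hG
  have hΓ1 : Measurable fun q : (Fin n → ℝ) × (ℕ → ℝ) => ∫⁻ S, Γ (q.1, q.2, S) ∂iidLaw ν :=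
    Measurable.lintegral_prod_right' (f := fun q : ((Fin n → ℝ) × (ℕ → ℝ)) × (ℕ → ℝ) =>
      Γ (q.1.1, q.1.2, q.2)) (hΓ.comp (by fun_prop))
  have hGm : Measurable G := hΓ1.lintegral_prod_right'
  have hmsub : Measurable fun x : ℝ => x - h := by fun_prop
  have hR : IsProbabilityMeasure (R.map fun x => x - h) :=
    Measure.isProbabilityMeasure_map hmsub.aemeasurable
  set μ : Measure (ℝ × ℝ) := (volume.restrict (Set.Ico 0 h)).prod ν with hμ
  have hmdiff : Measurable fun p : ℝ × ℝ => p.2 - p.1 := by fun_prop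
  -- For fixed initial jobs, integrate over arrivals and processing times.
  have h1 : ∀ x : Fin z → ℝ,
      ∫⁻ U, ∫⁻ S, averageAtTime Γ h z m x U S ∂iidLaw ν ∂iidLaw (expMeasure r) =
      ENNReal.ofReal (Real.exp (-(r * h))) * ((m.factorial : ENNReal)⁻¹ *
        (ENNReal.ofReal r ^ m * ∫⁻ y, averageAlive G (Sum.elim (fun i => x i - h) y)
          ∂Measure.pi (fun _ : Fin m => arrivalResidual ν h))) := by
    intro x
    set X : (Fin m → ℝ × ℝ) → Fin z ⊕ Fin m → ℝ :=
      fun w => Sum.elim (fun i => x i - h) (fun k => (w k).2 - (w k).1) with hX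
    have hXm : Measurable X := by
      refine measurable_pi_iff.2 ?_
      rintro (i | k)
      · exact measurable_const
      · simp only [hX, Sum.elim_inr]; fun_prop
    have e1 := lintegral_arrivedUpTo hr ν m h hh
      (fun q => averageAlive (fun y => Γ (y, q.2)) (X q.1))
      ((measurable_averageAlive_uncurry hΓ).comp
        (f := fun q : (Fin m → ℝ × ℝ) × (ℕ → ℝ) × (ℕ → ℝ) => (X q.1, q.2))
        ((hXm.comp measurable_fst).prodMk measurable_snd))
    have e2 : ∀ w, ∫⁻ U, ∫⁻ S, averageAlive (fun y => Γ (y, U, S)) (X w) ∂iidLaw ν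
        ∂iidLaw (expMeasure r) = averageAlive G (X w) := by
      intro w
      have : ∀ U : ℕ → ℝ, ∫⁻ S, averageAlive (fun y => Γ (y, U, S)) (X w) ∂iidLaw ν =
          averageAlive (fun y => ∫⁻ S, Γ (y, U, S) ∂iidLaw ν) (X w) := fun U =>
        lintegral_averageAlive (iidLaw ν) (G := fun q => Γ (q.1, U, q.2))
          (hΓ.comp (by fun_prop)) (X w)
      simp only [this]
      exact lintegral_averageAlive _ hΓ1 (X w)
    simp only [e2] at e1
    have hGX : Measurable fun w => averageAlive G (X w) := (measurable_averageAlive hGm).comp hXm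
    rw [setLIntegral_decreasingAges ν m h hGX] at e1
    · refine Eq.trans ?_ (e1.trans ?_)
      · rfl
      · rw [mul_comm (r ^ m), ENNReal.ofReal_mul (Real.exp_pos _).le, mul_assoc,
          ENNReal.ofReal_pow hr.le, mul_left_comm (ENNReal.ofReal r ^ m)]
        congr 3
        rw [arrivalResidual, ← Measure.pi_map_pi (fun _ => hmdiff.aemeasurable),
          lintegral_map ?_ (by fun_prop)]
        refine (measurable_averageAlive hGm).comp (measurable_pi_iff.2 ?_)
        rintro (i | k)
        · exact measurable_const
        · simp only [Sum.elim_inr]; fun_prop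
    · intro σ w
      refine Eq.trans (congrArg (averageAlive G) (funext fun i => ?_))
        (averageAlive_comp_equiv G (Equiv.sumCongr (Equiv.refl _) σ) (X w))
      rcases i with i | i <;> rfl
  simp only [h1]
  have hsm : Measure.pi (fun _ : Fin m => ENNReal.ofReal r • arrivalResidual ν h) =
      ENNReal.ofReal r ^ m • Measure.pi (fun _ : Fin m => arrivalResidual ν h) := by
    rw [pi_smul (fun _ => ENNReal.ofReal r) (fun _ => ENNReal.ofReal_ne_top)]
    simp
  have hfin : IsFiniteMeasure (ENNReal.ofReal r • arrivalResidual ν h) :=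
    Measure.smul_finite _ ENNReal.ofReal_ne_top
  have hmE : Measurable fun q : (Fin z → ℝ) × (Fin m → ℝ) =>
      averageAlive G (Sum.elim q.1 q.2) := by
    refine (measurable_averageAlive hGm).comp (measurable_pi_iff.2 ?_)
    rintro (i | k)
    · simp only [Sum.elim_inl]; fun_prop
    · simp only [Sum.elim_inr]; fun_prop
  have hmI : Measurable fun x : Fin z → ℝ => ∫⁻ y, averageAlive G (Sum.elim x y)
      ∂Measure.pi (fun _ : Fin m => arrivalResidual ν h) := hmE.lintegral_prod_right'
  have hmI' : Measurable fun x : Fin z → ℝ => ∫⁻ y, averageAlive G (Sum.elim (fun i => x i - h) y)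
      ∂Measure.pi (fun _ : Fin m => arrivalResidual ν h) := hmI.comp (by fun_prop)
  rw [populationIntegral_eq_lintegral_lintegral hGm, hsm]
  simp only [lintegral_smul_measure, smul_eq_mul]
  rw [lintegral_const_mul _ (by fun_prop), lintegral_const_mul _ (by fun_prop),
    lintegral_const_mul _ hmI', lintegral_const_mul _ hmI,
    ← Measure.pi_map_pi (fun _ => hmsub.aemeasurable), lintegral_map hmI (by fun_prop)]

/-- The infinite-server system is stationary: an average over the `n`-tuples of jobs that are
present at time `h` has the same expectation as for fresh independent residual lives, provided
that at least `n` jobs are present. -/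
lemma tsum_poissonMeasure_mul_lintegral_averageAtTime {r μS : ℝ} (hr : 0 < r) (hμS : 0 < μS)
    (hν_mean : ∫ x, x ∂ν = μS⁻¹) [IsProbabilityMeasure (expMeasure r)]
    [IsProbabilityMeasure (residualLife ν)]
    {Γ : (Fin n → ℝ) × (ℕ → ℝ) × (ℕ → ℝ) → ENNReal} (hΓ : Measurable Γ) {h : ℝ} (hh : 0 ≤ h) :
    ∑' z, ∑' m, poissonMeasure (r / μS).toNNReal {z} *
      ∫⁻ x, ∫⁻ U, ∫⁻ S, averageAtTime Γ h z m x U S ∂iidLaw ν ∂iidLaw (expMeasure r)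
        ∂Measure.pi (fun _ => residualLife ν) =
      poissonMeasure (r / μS).toNNReal {z | n ≤ z} *
        ∫⁻ y, ∫⁻ U, ∫⁻ S, Γ (y, U, S) ∂iidLaw ν ∂iidLaw (expMeasure r)
          ∂Measure.pi (fun _ => residualLife ν) := by
  have hρ : 0 ≤ r / μS := by positivity
  set R := residualLife ν with hR
  set ρ := ENNReal.ofReal (r / μS) with hρE
  set G : (Fin n → ℝ) → ENNReal :=
    fun y => ∫⁻ U, ∫⁻ S, Γ (y, U, S) ∂iidLaw ν ∂iidLaw (expMeasure r) with hG
  have hΓ1 : Measurable fun q : (Fin n → ℝ) × (ℕ → ℝ) => ∫⁻ S, Γ (q.1, q.2, S) ∂iidLaw ν :=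
    Measurable.lintegral_prod_right' (f := fun q : ((Fin n → ℝ) × (ℕ → ℝ)) × (ℕ → ℝ) =>
      Γ (q.1.1, q.1.2, q.2)) (hΓ.comp (by fun_prop))
  have hGm : Measurable G := hΓ1.lintegral_prod_right'
  have hmsub : Measurable fun x : ℝ => x - h := by fun_prop
  have hp : IsProbabilityMeasure (R.map fun x => x - h) :=
    Measure.isProbabilityMeasure_map hmsub.aemeasurable
  set N := ENNReal.ofReal r • arrivalResidual ν h with hN
  have hNf : IsFiniteMeasure N := Measure.smul_finite _ ENNReal.ofReal_ne_top
  have hMf : IsFiniteMeasure (ρ • R.map fun x => x - h) :=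
    Measure.smul_finite _ ENNReal.ofReal_ne_top
  have hRf : IsFiniteMeasure (ρ • R) := Measure.smul_finite _ ENNReal.ofReal_ne_top
  -- Split the intensity of all jobs into its parts on `(0, ∞)` (present) and `(-∞, 0]` (departed).
  set T := (ρ • R.map fun x => x - h) + N with hT
  have hpos : T.restrict (Set.Ioi 0) = ρ • R := restrict_residual_eq hr hμS hν_mean hh
  set D := T.restrict (Set.Iic 0) with hD
  have hsplit : T = ρ • R + D := by
    rw [← hpos, hD, ← Set.compl_Ioi, Measure.restrict_add_restrict_compl measurableSet_Ioi]
  have hDuniv : D Set.univ = ENNReal.ofReal (r * h) := by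
    have h1 : T Set.univ = ρ + ENNReal.ofReal (r * h) := by
      rw [hT, hN, Measure.add_apply, Measure.smul_apply, Measure.smul_apply, measure_univ,
        arrivalResidual_univ, smul_eq_mul, smul_eq_mul, mul_one, ENNReal.ofReal_mul hr.le]
    have h2 : T Set.univ = ρ + D Set.univ := by
      conv_lhs => rw [hsplit]
      rw [Measure.add_apply, Measure.smul_apply, measure_univ, smul_eq_mul, mul_one]
    exact (ENNReal.add_right_inj ENNReal.ofReal_ne_top).1 (h2.symm.trans h1)
  obtain ⟨D', hD'p, hD'0, hD'⟩ := exists_smul_probability D (by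
    rw [hD, Measure.restrict_apply measurableSet_Ioi, Set.Ioi_inter_Iic, Set.Ioc_self,
      measure_empty])
  rw [hDuniv] at hD'
  have hT' : T = ρ • R + ENNReal.ofReal (r * h) • D' := by rw [← hD']; exact hsplit
  have hDf : IsFiniteMeasure (ENNReal.ofReal (r * h) • D') :=
    Measure.smul_finite _ ENNReal.ofReal_ne_top
  have hsup := tsum_lintegral_pi_add G (ρ • R.map fun x => x - h) N
  have hthin := tsum_lintegral_pi_add G (ρ • R) (ENNReal.ofReal (r * h) • D')
  rw [← hT', hT, hsup] at hthin
  simp only [populationIntegral_smul_smul hGm R D' (residualLife_Iic ν) hD'0 (r := ρ)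
    ENNReal.ofReal_ne_top (b := ENNReal.ofReal (r * h)) ENNReal.ofReal_ne_top] at hthin
  have hscale : ∀ z m, populationIntegral G (ρ • R.map fun x => x - h) N z m =
      ρ ^ z * populationIntegral G (R.map fun x => x - h) N z m := by
    intro z m
    have : Measure.pi (fun _ : Fin z => ρ • R.map fun x => x - h) =
        ρ ^ z • Measure.pi (fun _ : Fin z => R.map fun x => x - h) := by
      rw [pi_smul (fun _ => ρ) (fun _ => ENNReal.ofReal_ne_top)]
      simp
    rw [populationIntegral_eq_lintegral_lintegral hGm,
      populationIntegral_eq_lintegral_lintegral hGm, this, lintegral_smul_measure, smul_eq_mul]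
  have hterm : ∀ z m, poissonMeasure (r / μS).toNNReal {z} *
      ∫⁻ x, ∫⁻ U, ∫⁻ S, averageAtTime Γ h z m x U S ∂iidLaw ν ∂iidLaw (expMeasure r)
        ∂Measure.pi (fun _ => R) =
      (ENNReal.ofReal (Real.exp (-(r / μS))) * ENNReal.ofReal (Real.exp (-(r * h)))) *
      ((z.factorial : ENNReal)⁻¹ * (m.factorial : ENNReal)⁻¹ *
        populationIntegral G (ρ • R.map fun x => x - h) N z m) := by
    intro z m
    rw [lintegral_averageAtTime hr hΓ hh R z m, poissonMeasure_singleton_eq hρ, hscale]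
    ring
  simp only [hterm, ENNReal.tsum_mul_left]
  rw [hthin, poissonMeasure_le_eq hρ]
  have hfac : ∀ z m : ℕ, (z.factorial : ENNReal)⁻¹ * (m.factorial : ENNReal)⁻¹ *
      (ρ ^ z * ENNReal.ofReal (r * h) ^ m *
        if n ≤ z then ∫⁻ y, G y ∂Measure.pi (fun _ => R) else 0) =
      ((z.factorial : ENNReal)⁻¹ * (ρ ^ z * if n ≤ z then 1 else 0) *
        ∫⁻ y, G y ∂Measure.pi (fun _ => R)) *
        ((m.factorial : ENNReal)⁻¹ * ENNReal.ofReal (r * h) ^ m) := by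
    intro z m
    split_ifs <;> ring
  simp only [hfac, ENNReal.tsum_mul_left, ENNReal.tsum_mul_right]
  rw [tsum_pow_mul_inv_factorial (by positivity)]
  have hexp : ENNReal.ofReal (Real.exp (-(r * h))) * ENNReal.ofReal (Real.exp (r * h)) = 1 := by
    rw [← ENNReal.ofReal_mul (Real.exp_pos _).le, ← Real.exp_add, neg_add_cancel, Real.exp_zero,
      ENNReal.ofReal_one]
  calc _ = (ENNReal.ofReal (Real.exp (-(r * h))) * ENNReal.ofReal (Real.exp (r * h))) *
      ((ENNReal.ofReal (Real.exp (-(r / μS))) *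
      ∑' z : ℕ, (z.factorial : ENNReal)⁻¹ * (ρ ^ z * if n ≤ z then 1 else 0)) *
        ∫⁻ y, G y ∂Measure.pi (fun _ => R)) := by ring
    _ = _ := by rw [hexp, one_mul]

end

/-! ### Event counts of equilibrium renewal processes -/

lemma infinitePi_congr {α : Type*} [MeasurableSpace α] {μ μ' : ℕ → Measure α}
    [∀ k, IsProbabilityMeasure (μ k)] [∀ k, IsProbabilityMeasure (μ' k)] (h : μ = μ') :
    Measure.infinitePi μ = Measure.infinitePi μ' := by
  subst h; rfl

lemma map_eq_iidLaw {Ω : Type*} [MeasurableSpace Ω] {P : Measure Ω} [IsProbabilityMeasure P]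
    {ν : Measure ℝ} [IsProbabilityMeasure ν] {V : ℕ → Ω → ℝ} (hm : ∀ k, Measurable (V k))
    (hlaw : ∀ k, P.map (V k) = ν) (hindep : iIndepFun V P) :
    P.map (fun ω k => V k ω) = iidLaw ν := by
  have hp : ∀ k, IsProbabilityMeasure (P.map (V k)) := fun k =>
    Measure.isProbabilityMeasure_map (hm k).aemeasurable
  rw [(iIndepFun_iff_map_fun_eq_infinitePi_map hm).1 hindep]
  exact infinitePi_congr (funext hlaw)

namespace IsEquilibriumRenewal

variable {Ω : Type*} [MeasurableSpace Ω] {P : Measure Ω} {ν : Measure ℝ} {V : ℕ → Ω → ℝ}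

lemma ae_pos (hV : IsEquilibriumRenewal P ν V) (hν : ν (Set.Iic 0) = 0) :
    ∀ᵐ ω ∂P, ∀ k, 0 < V k ω := by
  rw [ae_all_iff]
  intro k
  have h : P.map (V k) (Set.Iic 0) = 0 := by
    cases k with
    | zero => rw [hV.law_first, residualLife_Iic]
    | succ k => rw [hV.law_succ, hν]
  rw [Measure.map_apply (hV.measurable k) measurableSet_Iic] at h
  rw [ae_iff]
  simp only [not_lt]
  exact h

variable [IsProbabilityMeasure P]

lemma map_eq [IsProbabilityMeasure ν] [IsProbabilityMeasure (residualLife ν)]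
    (hV : IsEquilibriumRenewal P ν V) :
    P.map (fun ω k => V k ω) =
      ((residualLife ν).prod (iidLaw ν)).map fun q => seqCons q.1 q.2 := by
  have hp : ∀ k, IsProbabilityMeasure (P.map (V k)) := fun k =>
    Measure.isProbabilityMeasure_map (hV.measurable k).aemeasurable
  rw [(iIndepFun_iff_map_fun_eq_infinitePi_map hV.measurable).1 hV.indep,
    ← (measurePreserving_seqCons fun k => P.map (V k)).map_eq, hV.law_first,
    infinitePi_congr (funext hV.law_succ)]

/-- By the strong law of large numbers for the truncated inter-event times `min (V k) 1`, the event
times tend to infinity. -/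
lemma ae_tendsto_eventTime (hV : IsEquilibriumRenewal P ν V) (hν : ν (Set.Iic 0) = 0) :
    ∀ᵐ ω ∂P, Filter.Tendsto (fun k => eventTime (fun j => V j ω) k) Filter.atTop Filter.atTop := by
  set g : ℝ → ℝ := fun x => min (max x 0) 1 with hg
  have hgm : Measurable g := by fun_prop
  have hg0 : ∀ x, 0 ≤ g x := fun x => le_min (le_max_right _ _) zero_le_one
  have hg1 : ∀ x, g x ≤ 1 := fun x => min_le_right _ _
  set X : ℕ → Ω → ℝ := fun k ω => g (V (k + 1) ω) with hX
  have hXm : ∀ k, Measurable (X k) := fun k => hgm.comp (hV.measurable _)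
  have hint : Integrable (X 0) P :=
    Integrable.of_bound (hXm 0).aestronglyMeasurable 1 (ae_of_all _ fun ω => by
      rw [Real.norm_eq_abs, abs_of_nonneg (hg0 _)]; exact hg1 _)
  have hindep : Pairwise (Function.onFun (fun f f' => IndepFun f f' P) X) := by
    intro i j hij
    exact (hV.indep.indepFun (fun h => hij (Nat.succ_injective h))).comp hgm hgm
  have hident : ∀ i, IdentDistrib (X i) (X 0) P P := by
    intro i
    have : IdentDistrib (V (i + 1)) (V (0 + 1)) P P :=
      ⟨(hV.measurable _).aemeasurable, (hV.measurable _).aemeasurable, by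
        rw [hV.law_succ, hV.law_succ]⟩
    exact this.comp hgm
  have hpos := hV.ae_pos hν
  have hmean : 0 < ∫ ω, X 0 ω ∂P := by
    rw [integral_pos_iff_support_of_nonneg (fun ω => hg0 _) hint]
    have : ∀ᵐ ω ∂P, ω ∈ Function.support (X 0) := by
      filter_upwards [hpos] with ω hω
      have : 0 < g (V (0 + 1) ω) := lt_min (lt_max_of_lt_left (hω _)) one_pos
      exact this.ne'
    have h1 : P (Function.support (X 0)) = 1 := by
      rw [← measure_univ (μ := P)]
      exact measure_congr (Filter.eventuallyEq_univ.2 this)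
    rw [h1]; exact one_pos
  filter_upwards [hpos, strong_law_ae_real X hint hindep hident] with ω hω hlim
  have h1 : Filter.Tendsto (fun k : ℕ => (k : ℝ) * ((∑ i ∈ Finset.range k, X i ω) / k))
      Filter.atTop Filter.atTop :=
    tendsto_natCast_atTop_atTop.atTop_mul_pos hmean hlim
  refine Filter.tendsto_atTop_mono (fun k => ?_) h1
  rcases Nat.eq_zero_or_pos k with rfl | hk
  · simpa [eventTime] using (hω 0).le
  · rw [mul_div_cancel₀ _ (by exact_mod_cast hk.ne'), eventTime, Finset.sum_range_succ']
    have : ∑ i ∈ Finset.range k, X i ω ≤ ∑ i ∈ Finset.range k, V (i + 1) ω :=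
      Finset.sum_le_sum fun i _ => (min_le_left _ _).trans (max_le le_rfl (hω _).le)
    linarith [hω 0]

end IsEquilibriumRenewal

lemma eventTime_strictMono {V : ℕ → ℝ} (hV : ∀ k, 0 < V k) : StrictMono (eventTime V) := by
  refine strictMono_nat_of_lt_succ fun k => ?_
  rw [eventTime, eventTime, Finset.sum_range_succ _ (k + 1)]
  linarith [hV (k + 1)]

lemma exists_eventTime_le_iff {V : ℕ → ℝ} (hV : ∀ k, 0 < V k)
    (hlim : Filter.Tendsto (eventTime V) Filter.atTop Filter.atTop) (s : ℝ) :
    ∃ M, ∀ k, eventTime V k ≤ s ↔ k < M := by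
  classical
  have hex : ∃ k, s < eventTime V k := (hlim.eventually_gt_atTop s).exists
  refine ⟨Nat.find hex, fun k => ?_⟩
  rw [Nat.lt_find_iff]
  constructor
  · intro h j hj
    exact not_lt.2 (((eventTime_strictMono hV).monotone hj).trans h)
  · intro h
    exact not_lt.1 (h k le_rfl)

lemma eventCount_eq {V : ℕ → ℝ} {s : ℝ} {M : ℕ} (h : ∀ k, eventTime V k ≤ s ↔ k < M) :
    eventCount V s = M := by
  have : {k | eventTime V k ≤ s} = (Finset.range M : Set ℕ) := by ext k; simp [h]
  rw [eventCount, this, Set.ncard_coe_finset, Finset.card_range]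

lemma eventCountENN_eq {V : ℕ → ℝ} {s : ℝ} {M : ℕ} (h : ∀ k, eventTime V k ≤ s ↔ k < M) :
    eventCountENN V s = M := by
  rw [eventCountENN, tsum_eq_sum (s := Finset.range M)]
  · rw [Finset.sum_congr rfl fun k hk => by
      rw [leInd, if_pos ((h k).2 (Finset.mem_range.1 hk))]]
    simp
  · intro k hk
    rw [leInd, if_neg fun h' => hk (Finset.mem_range.2 ((h k).1 h'))]

lemma arrivedUpTo_iff {V : ℕ → ℝ} (hV : ∀ k, 0 < V k) (m : ℕ) (h : ℝ) :
    ArrivedUpTo m h V ↔ ∀ k, eventTime V k ≤ h ↔ k < m := by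
  constructor
  · rintro ⟨h1, h2⟩ k
    refine ⟨fun hk => ?_, h1 k⟩
    by_contra hkm
    exact absurd (h2.trans_le ((eventTime_strictMono hV).monotone (not_lt.1 hkm))) (not_lt.2 hk)
  · intro hk
    exact ⟨fun k => (hk k).2, not_le.1 fun h' => lt_irrefl m ((hk m).1 h')⟩

/-! ### The lower bound at a fixed time -/

section
variable {n : ℕ} [NeZero n]

/-- Of `n` jobs with residual processing times `y`, and of the jobs with inter-arrival times `U` and
processing times `S`, served by `n` servers, more than `n + x` are in system at time `s`. -/
def overloadSet (n : ℕ) [NeZero n] (x s : ℝ) : Set ((Fin n → ℝ) × (ℕ → ℝ) × (ℕ → ℝ)) :=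
  {q | ∃ M : ℕ, (∀ k, eventTime q.2.1 k ≤ s ↔ k < M) ∧
    ENNReal.ofReal x + departures s M (eventTime q.2.1) q.1 q.2.2 < M}

lemma measurableSet_eventTime_le_iff (s : ℝ) (M : ℕ) :
    MeasurableSet {U : ℕ → ℝ | ∀ k, eventTime U k ≤ s ↔ k < M} := by
  rw [Set.ofPred_forall]
  refine MeasurableSet.iInter fun k => ?_
  exact (measurableSet_le (measurable_eventTime k) measurable_const).iff (MeasurableSet.const _)

lemma measurableSet_overloadSet (x s : ℝ) : MeasurableSet (overloadSet n x s) := by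
  rw [overloadSet, Set.ofPred_exists]
  refine MeasurableSet.iUnion fun M => MeasurableSet.inter
    ((measurable_fst.comp measurable_snd) (measurableSet_eventTime_le_iff s M)) ?_
  refine measurableSet_lt (measurable_const.add ((measurable_departures s M).comp
    (f := fun q : (Fin n → ℝ) × (ℕ → ℝ) × (ℕ → ℝ) => (eventTime q.2.1, q.1, q.2.2)) ?_))
    measurable_const
  refine Measurable.prodMk (measurable_pi_iff.2 fun k => ?_) (by fun_prop)
  exact (measurable_eventTime k).comp (by fun_prop)

/-- If `n` of the jobs that an infinite-server system would still hold at time `h`, together with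
the later arrivals, overload the `n` servers at time `t`, then so do all jobs. -/
lemma lt_numberInSystem_of_mem_overloadSet {x h t : ℝ} (hx : 0 < x) (hh : 0 ≤ h) (hht : h ≤ t)
    {z m : ℕ} {σ : ℕ → ℕ} (hσ : Set.BijOn σ (Set.Iio z) (Set.Iio z)) {r s u : ℕ → ℝ}
    (hu : ∀ k, 0 < u k) (hm : ArrivedUpTo m h u) (e : Fin n ↪ Fin z ⊕ Fin m)
    (hgood : ((fun a => Sum.elim (fun i : Fin z => r i - h)
      (fun k : Fin m => s k - (h - eventTime u k)) (e a)), interEventAfter m h u,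
      fun k => s (m + k)) ∈ overloadSet n x (t - h)) :
    x < max ((numberInSystem n (arrivalTimes z u) (processingTimes z σ r s) t : ℝ) - n) 0 := by
  obtain ⟨M, hM, hlt⟩ := hgood
  simp only at hM hlt
  have hm' := (arrivedUpTo_iff hu m h).1 hm
  -- the position in the queue of the job with label `i`
  have hpos : ∀ i : Fin z, ∃ k < z, σ k = i := fun i => by
    obtain ⟨k, hk, hk'⟩ := hσ.surjOn (Set.mem_Iio.2 i.2)
    exact ⟨k, hk, hk'⟩
  choose τ hτ hτσ using hpos
  set c : Fin z ⊕ Fin m → ℕ := Sum.elim τ (fun k => z + k) with hc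
  have hcinj : Function.Injective c := by
    rintro (i | i) (j | j) hij
    · have : (i : ℕ) = j := by rw [← hτσ i, ← hτσ j]; exact congrArg σ hij
      exact congrArg _ (Fin.ext this)
    · have := hτ i; simp only [hc, Sum.elim_inl, Sum.elim_inr] at hij; omega
    · have := hτ j; simp only [hc, Sum.elim_inl, Sum.elim_inr] at hij; omega
    · simp only [hc, Sum.elim_inr] at hij
      exact congrArg _ (Fin.ext (by omega))
  have hclt : ∀ i, c i < z + m := by
    rintro (i | i)
    · exact (hτ i).trans_le (Nat.le_add_right _ _)
    · exact Nat.add_lt_add_left i.2 _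
  have ha : ∀ k, arrivalTimes z u k ≤ t ↔ k < z + m + M := by
    intro k
    rw [arrivalTimes]
    split_ifs with hk
    · exact ⟨fun _ => by omega, fun _ => hh.trans hht⟩
    · obtain ⟨j, rfl⟩ := Nat.exists_eq_add_of_le (not_lt.1 hk)
      rw [Nat.add_sub_cancel_left]
      rcases lt_or_ge j m with hj | hj
      · exact ⟨fun _ => by omega, fun _ => ((hm' j).2 hj).trans hht⟩
      · obtain ⟨l, rfl⟩ := Nat.exists_eq_add_of_le hj
        have := hM l
        rw [eventTime_interEventAfter] at this
        constructor
        · intro h1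
          have := this.1 (by linarith)
          omega
        · intro h1
          have := this.2 (by omega)
          linarith
  have hy : ∀ i, h + Sum.elim (fun i : Fin z => r i - h)
      (fun k : Fin m => s k - (h - eventTime u k)) i ≤
      arrivalTimes z u (c i) + processingTimes z σ r s (c i) := by
    rintro (i | i)
    · simp [hc, arrivalTimes, processingTimes, hτ, hτσ]
    · simp only [hc, arrivalTimes, processingTimes, Sum.elim_inr]
      rw [if_neg (by omega), if_neg (by omega), Nat.add_sub_cancel_left]
      linarith
  have key := le_numberInSystem_add_departures (arrivalTimes z u) (processingTimes z σ r s) h t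
    (z + m) M (fun a => c (e a)) _ (hcinj.comp e.injective) (fun a => hclt _) ha (fun a => hy (e a))
  have e1 : (fun l => arrivalTimes z u (z + m + l) - h) = eventTime (interEventAfter m h u) := by
    funext l
    rw [arrivalTimes, if_neg (by omega), eventTime_interEventAfter,
      show z + m + l - z = m + l by omega]
  have e2 : (fun l => processingTimes z σ r s (z + m + l)) = fun k => s (m + k) := by
    funext l
    rw [processingTimes, if_neg (by omega), show z + m + l - z = m + l by omega]
  rw [e1, e2] at key
  set Q := numberInSystem n (arrivalTimes z u) (processingTimes z σ r s) t
  have hQ : (n : ENNReal) + ENNReal.ofReal x < Q := by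
    refine lt_of_add_lt_add_right (lt_of_lt_of_le ?_ key)
    rw [add_assoc]
    exact ENNReal.add_lt_add_left (ENNReal.natCast_ne_top _) hlt
  rw [← ENNReal.ofReal_natCast, ← ENNReal.ofReal_natCast,
    ← ENNReal.ofReal_add (by positivity) hx.le,
    ENNReal.ofReal_lt_ofReal_iff_of_nonneg (by positivity)] at hQ
  exact lt_max_of_lt_left (by linarith)

/-- The bound for the number of events, in terms of the `n`-server system that starts from
independent residual processing times. -/
lemma measure_renewal_le_lintegral_overloadSet {Ω' : Type*} [MeasurableSpace Ω'] {P' : Measure Ω'}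
    [IsProbabilityMeasure P'] {r : ℝ} (hr : 0 < r) {ν : Measure ℝ} [IsProbabilityMeasure ν]
    (hν_pos : ν (Set.Iic 0) = 0) [IsProbabilityMeasure (residualLife ν)]
    [IsProbabilityMeasure (expMeasure r)]
    {a : ℕ → Ω' → ℝ} {v : Fin n → ℕ → Ω' → ℝ}
    (ha : IsEquilibriumRenewal P' (expMeasure r) a)
    (hv : ∀ i, IsEquilibriumRenewal P' ν (v i))
    (hv_indep : iIndepFun (fun i ω => (fun j => v i j ω : ℕ → ℝ)) P')
    (hav_indep : IndepFun (fun ω => (fun j => a j ω : ℕ → ℝ))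
      (fun ω => (fun i j => v i j ω : Fin n → ℕ → ℝ)) P') {x : ℝ} (hx : 0 < x) (s : ℝ) :
    P' {ω | x < (eventCount (fun j => a j ω) s : ℝ) -
        ∑ i : Fin n, (eventCount (fun j => v i j ω) s : ℝ)} ≤
      ∫⁻ y, ∫⁻ U, ∫⁻ S, (overloadSet n x s).indicator 1 (y, U, S) ∂iidLaw ν
        ∂iidLaw (expMeasure r) ∂Measure.pi (fun _ => residualLife ν) := by
  set T : Set ((ℕ → ℝ) × (Fin n → ℕ → ℝ)) := {q | ∃ M : ℕ, (∀ k, eventTime q.1 k ≤ s ↔ k < M) ∧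
    ENNReal.ofReal x + ∑ i, eventCountENN (q.2 i) s < M} with hT
  have hTm : MeasurableSet T := by
    rw [hT, Set.ofPred_exists]
    refine MeasurableSet.iUnion fun M => MeasurableSet.inter
      (measurable_fst (measurableSet_eventTime_le_iff s M)) ?_
    have hm : Measurable fun q : (ℕ → ℝ) × (Fin n → ℕ → ℝ) =>
        ENNReal.ofReal x + ∑ i, eventCountENN (q.2 i) s :=
      measurable_const.add (Finset.measurable_sum _ fun i _ =>
        (measurable_eventCountENN s).comp (by fun_prop))
    exact measurableSet_lt hm measurable_const
  have hexp0 : expMeasure r (Set.Iic 0) = 0 := by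
    rw [← residualLife_expMeasure hr]; exact residualLife_Iic _
  have hsub : P' {ω | x < (eventCount (fun j => a j ω) s : ℝ) -
        ∑ i : Fin n, (eventCount (fun j => v i j ω) s : ℝ)} ≤
      P' ((fun ω => ((fun j => a j ω : ℕ → ℝ), (fun i j => v i j ω : Fin n → ℕ → ℝ))) ⁻¹' T) := by
    refine measure_mono_ae ?_
    have h1 : ∀ᵐ ω ∂P', ∀ i, (∀ k, 0 < v i k ω) ∧
        Filter.Tendsto (eventTime fun j => v i j ω) Filter.atTop Filter.atTop := by
      rw [ae_all_iff]
      exact fun i => ((hv i).ae_pos hν_pos).and ((hv i).ae_tendsto_eventTime hν_pos)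
    filter_upwards [h1, ha.ae_pos hexp0, ha.ae_tendsto_eventTime hexp0] with ω hω h2 h3 hlt
    obtain ⟨M, hM⟩ := exists_eventTime_le_iff h2 h3 s
    choose K hK using fun i => exists_eventTime_le_iff (hω i).1 (hω i).2 s
    refine ⟨M, hM, ?_⟩
    change x < _ at hlt
    simp only [eventCount_eq hM, fun i => eventCount_eq (hK i)] at hlt
    simp only [fun i => eventCountENN_eq (hK i)]
    rw [← Nat.cast_sum, ← ENNReal.ofReal_natCast, ← ENNReal.ofReal_natCast,
      ← ENNReal.ofReal_add hx.le (by positivity), ENNReal.ofReal_lt_ofReal_iff_of_nonneg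
        (by positivity)]
    push_cast
    linarith
  refine hsub.trans ?_
  have hma : Measurable fun ω => (fun j => a j ω : ℕ → ℝ) := measurable_pi_iff.2 ha.measurable
  have hmv : ∀ i, Measurable fun ω => (fun j => v i j ω : ℕ → ℝ) := fun i =>
    measurable_pi_iff.2 (hv i).measurable
  have hmv' : Measurable fun ω => (fun i j => v i j ω : Fin n → ℕ → ℝ) := measurable_pi_iff.2 hmv
  have hlawa : P'.map (fun ω => (fun j => a j ω : ℕ → ℝ)) = iidLaw (expMeasure r) :=
    map_eq_iidLaw ha.measurable (fun k => by
      cases k with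
      | zero => rw [ha.law_first, residualLife_expMeasure hr]
      | succ k => exact ha.law_succ k) ha.indep
  -- The joint law of the renewal processes, with the first inter-event times separated.
  have hlawv : P'.map (fun ω => (fun i j => v i j ω : Fin n → ℕ → ℝ)) =
      ((Measure.pi fun _ : Fin n => residualLife ν).prod
        (Measure.pi fun _ : Fin n => iidLaw ν)).map fun q i => seqCons (q.1 i) (q.2 i) := by
    have hmp := (measurePreserving_arrowProdEquivProdArrow ℝ (ℕ → ℝ) (Fin n)
      (fun _ => residualLife ν) (fun _ => iidLaw ν))
    rw [(iIndepFun_iff_map_fun_eq_pi_map fun i => (hmv i).aemeasurable).1 hv_indep]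
    simp only [(hv _).map_eq]
    have hpm : ∀ i : Fin n, IsProbabilityMeasure
        (((residualLife ν).prod (iidLaw ν)).map fun q => seqCons q.1 q.2) := fun _ =>
      Measure.isProbabilityMeasure_map measurable_seqCons.aemeasurable
    rw [← Measure.pi_map_pi (fun _ => measurable_seqCons.aemeasurable), ← hmp.map_eq,
      Measure.map_map ?_ hmp.measurable]
    · rfl
    · refine measurable_pi_iff.2 fun i => measurable_seqCons.comp
        (f := fun q : (Fin n → ℝ) × (Fin n → ℕ → ℝ) => (q.1 i, q.2 i)) (by fun_prop)
  have hmc : Measurable fun q : (Fin n → ℝ) × (Fin n → ℕ → ℝ) =>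
      (fun i => seqCons (q.1 i) (q.2 i) : Fin n → ℕ → ℝ) :=
    measurable_pi_iff.2 fun i => measurable_seqCons.comp
      (f := fun q : (Fin n → ℝ) × (Fin n → ℕ → ℝ) => (q.1 i, q.2 i)) (by fun_prop)
  rw [← Measure.map_apply (hma.prodMk hmv') hTm,
    (indepFun_iff_map_prod_eq_prod_map_map hma.aemeasurable hmv'.aemeasurable).1 hav_indep,
    hlawa, hlawv, Measure.prod_apply hTm, lintegral_lintegral_swap]
  · refine lintegral_mono fun U => ?_
    have hTU : MeasurableSet (Prod.mk U ⁻¹' T) := measurable_prodMk_left hTm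
    rw [Measure.map_apply hmc hTU, Measure.prod_apply (hmc hTU)]
    refine lintegral_mono fun y => ?_
    have hOm : MeasurableSet {S | (y, U, S) ∈ overloadSet n x s} :=
      (measurableSet_overloadSet x s).preimage (by fun_prop)
    have e1 : ∫⁻ S, (overloadSet n x s).indicator 1 (y, U, S) ∂iidLaw ν =
        iidLaw ν {S | (y, U, S) ∈ overloadSet n x s} := by
      rw [← lintegral_indicator_one hOm]; rfl
    rw [e1]
    by_cases hU : ∃ M, ∀ k, eventTime U k ≤ s ↔ k < M
    · obtain ⟨M, hM⟩ := hU
      refine le_trans (measure_mono ?_) ((measure_renewal_le_measure_departures ν s M M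
        (eventTime U) y (ENNReal.ofReal x)).trans (measure_mono ?_))
      · rintro V ⟨M', hM', hlt⟩
        have : M' = M := by
          rw [← eventCount_eq hM, ← eventCount_eq hM']
        subst this
        exact hlt
      · intro S hS
        exact ⟨M, hM, hS⟩
    · refine le_of_eq_of_le ((congrArg _ ?_).trans measure_empty) bot_le
      ext V
      simp only [Set.mem_preimage, Set.mem_empty_iff_false, iff_false]
      rintro ⟨M, hM, -⟩
      exact hU ⟨M, hM⟩
  · refine Measurable.aemeasurable ?_
    refine Measurable.lintegral_prod_right' (f := fun q : ((Fin n → ℝ) × (ℕ → ℝ)) × (ℕ → ℝ) =>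
      (overloadSet n x s).indicator 1 (q.1.1, q.1.2, q.2)) ?_
    exact (measurable_const.indicator (measurableSet_overloadSet x s)).comp (by fun_prop)

end

/-- The average over the `n`-tuples of jobs that are present in the infinite-server system at time
`t - s` bounds the indicator of more than `x` waiting jobs at time `t` from below; its expectation
is known by stationarity. -/
lemma mul_measure_renewal_le_measure_waiting
    (n : ℕ) [NeZero n] {μA μS : ℝ} (hμA : 0 < μA) (hμS : 0 < μS)
    (ν : Measure ℝ) [IsProbabilityMeasure ν] (hν_pos : ν (Set.Iic 0) = 0)
    (hν_mean : ∫ x, x ∂ν = μS⁻¹)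
    {Ω : Type*} [MeasurableSpace Ω] (P : Measure Ω) [IsProbabilityMeasure P]
    (Z : Ω → ℕ) (ord : ℕ → ℕ → Ω → ℕ) (R U S : ℕ → Ω → ℝ)
    (hQ : IsMGInData P n μA μS ν Z ord R U S)
    {Ω' : Type*} [MeasurableSpace Ω'] (P' : Measure Ω') [IsProbabilityMeasure P']
    (a : ℕ → Ω' → ℝ) (v : Fin n → ℕ → Ω' → ℝ)
    (ha : IsEquilibriumRenewal P' (expMeasure μA) a)
    (hv : ∀ i, IsEquilibriumRenewal P' ν (v i))
    (hv_indep : iIndepFun (fun i ω => (fun j => v i j ω : ℕ → ℝ)) P')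
    (hav_indep : IndepFun (fun ω => (fun j => a j ω : ℕ → ℝ))
      (fun ω => (fun i j => v i j ω : Fin n → ℕ → ℝ)) P')
    {x : ℝ} (hx : 0 < x) {s t : ℝ} (hs : 0 ≤ s) (hst : s ≤ t) :
    P {ω | n ≤ Z ω} * P' {ω | x < (eventCount (fun j => a j ω) s : ℝ) -
        ∑ i : Fin n, (eventCount (fun j => v i j ω) s : ℝ)} ≤
      P {ω | x < max ((queueNumber n Z ord R U S t ω : ℝ) - n) 0} := by
  have hexp := isProbabilityMeasure_expMeasure hμA
  have hres : IsProbabilityMeasure (residualLife ν) := by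
    rw [← hQ.law_R 0]
    exact Measure.isProbabilityMeasure_map (hQ.measurable_R 0).aemeasurable
  have hexp0 : expMeasure μA (Set.Iic 0) = 0 := by
    rw [← residualLife_expMeasure hμA]; exact residualLife_Iic _
  set Γ : (Fin n → ℝ) × (ℕ → ℝ) × (ℕ → ℝ) → ENNReal := (overloadSet n x s).indicator 1 with hΓ
  have hΓm : Measurable Γ := measurable_const.indicator (measurableSet_overloadSet x s)
  set h := t - s with hh
  have hh0 : 0 ≤ h := sub_nonneg.2 hst
  -- joint law of the data
  have hmR : Measurable fun ω => (fun i => R i ω : ℕ → ℝ) := measurable_pi_iff.2 hQ.measurable_R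
  have hmU : Measurable fun ω => (fun i => U i ω : ℕ → ℝ) :=
    measurable_pi_iff.2 hQ.arrivals.measurable
  have hmS : Measurable fun ω => (fun i => S i ω : ℕ → ℝ) := measurable_pi_iff.2 hQ.measurable_S
  have hlawR := map_eq_iidLaw hQ.measurable_R hQ.law_R hQ.indep_R
  have hlawS := map_eq_iidLaw hQ.measurable_S hQ.law_S hQ.indep_S
  have hlawU : P.map (fun ω => (fun j => U j ω : ℕ → ℝ)) = iidLaw (expMeasure μA) :=
    map_eq_iidLaw hQ.arrivals.measurable (fun k => by
      cases k with
      | zero => rw [hQ.arrivals.law_first, residualLife_expMeasure hμA]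
      | succ k => exact hQ.arrivals.law_succ k) hQ.arrivals.indep
  have hindZ : IndepFun Z (fun ω => ((fun i => R i ω : ℕ → ℝ), (fun k => U k ω : ℕ → ℝ),
      (fun k => S k ω : ℕ → ℝ))) P :=
    hQ.indep_Z_rest.comp measurable_id measurable_snd
  have hlaw : P.map (fun ω => (Z ω, (fun i => R i ω : ℕ → ℝ), (fun k => U k ω : ℕ → ℝ),
      (fun k => S k ω : ℕ → ℝ))) = (poissonMeasure (μA / μS).toNNReal).prod
        ((iidLaw (residualLife ν)).prod ((iidLaw (expMeasure μA)).prod (iidLaw ν))) := by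
    rw [(indepFun_iff_map_prod_eq_prod_map_map hQ.measurable_Z.aemeasurable
        (hmR.prodMk (hmU.prodMk hmS)).aemeasurable).1 hindZ,
      (indepFun_iff_map_prod_eq_prod_map_map hmR.aemeasurable
        (hmU.prodMk hmS).aemeasurable).1 hQ.indep_R_rest,
      (indepFun_iff_map_prod_eq_prod_map_map hmU.aemeasurable hmS.aemeasurable).1 hQ.indep_U_S,
      hQ.law_Z, hlawR, hlawU, hlawS]
  -- the average over the jobs present at time `h`, on the event of `m` arrivals
  set Ψ : ℕ → ℕ × (ℕ → ℝ) × (ℕ → ℝ) × (ℕ → ℝ) → ENNReal := fun m q =>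
    averageAtTime Γ h q.1 m (fun i => q.2.1 i) q.2.2.1 q.2.2.2 with hΨ
  have hΨm : ∀ m, Measurable (Ψ m) := fun m =>
    measurable_from_prod_countable_right fun z => (measurable_averageAtTime hΓm h z m).comp
      (f := fun q : (ℕ → ℝ) × (ℕ → ℝ) × (ℕ → ℝ) => (fun i : Fin z => q.1 i, q.2.1, q.2.2))
      (by fun_prop)
  have hΨint : ∀ m, ∫⁻ ω, Ψ m (Z ω, (fun i => R i ω), (fun k => U k ω), (fun k => S k ω)) ∂P =
      ∑' z, poissonMeasure (μA / μS).toNNReal {z} *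
        ∫⁻ x, ∫⁻ U, ∫⁻ S, averageAtTime Γ h z m x U S ∂iidLaw ν ∂iidLaw (expMeasure μA)
          ∂Measure.pi (fun _ => residualLife ν) := by
    intro m
    rw [← lintegral_map (hΨm m) (hQ.measurable_Z.prodMk (hmR.prodMk (hmU.prodMk hmS))), hlaw,
      lintegral_prod _ (hΨm m).aemeasurable, lintegral_countable']
    refine tsum_congr fun z => ?_
    rw [mul_comm]
    congr 1
    have hm1 : Measurable fun q : (Fin z → ℝ) × (ℕ → ℝ) × (ℕ → ℝ) =>
        averageAtTime Γ h z m q.1 q.2.1 q.2.2 := measurable_averageAtTime hΓm h z m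
    have hm2 : Measurable fun q : (Fin z → ℝ) × (ℕ → ℝ) =>
        ∫⁻ S, averageAtTime Γ h z m q.1 q.2 S ∂iidLaw ν :=
      Measurable.lintegral_prod_right' (f := fun q : ((Fin z → ℝ) × (ℕ → ℝ)) × (ℕ → ℝ) =>
        averageAtTime Γ h z m q.1.1 q.1.2 q.2) (hm1.comp MeasurableEquiv.prodAssoc.measurable)
    have hm3 : Measurable fun x : Fin z → ℝ => ∫⁻ U, ∫⁻ S, averageAtTime Γ h z m x U S ∂iidLaw ν
        ∂iidLaw (expMeasure μA) := hm2.lintegral_prod_right'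
    have hmarg : (iidLaw (residualLife ν)).map (fun r (i : Fin z) => r i) =
        Measure.pi fun _ => residualLife ν := by
      rw [← Measure.infinitePi_eq_pi]
      exact Measure.map_infinitePi_infinitePi_of_inj Fin.val_injective
    have hmr : Measurable fun (r : ℕ → ℝ) (i : Fin z) => r i := by fun_prop
    have hm4 : Measurable fun q => Ψ m (z, q) := (hΨm m).comp measurable_prodMk_left
    rw [← hmarg, lintegral_map hm3 hmr, lintegral_prod _ hm4.aemeasurable]
    refine lintegral_congr fun r => ?_
    have hm5 : Measurable fun q => Ψ m (z, r, q) := hm4.comp measurable_prodMk_left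
    rw [lintegral_prod _ hm5.aemeasurable]
  -- pathwise comparison
  have hle : ∀ᵐ ω ∂P, ∑' m, Ψ m (Z ω, (fun i => R i ω), (fun k => U k ω), (fun k => S k ω)) ≤
      {ω | x < max ((queueNumber n Z ord R U S t ω : ℝ) - n) 0}.indicator 1 ω := by
    filter_upwards [hQ.arrivals.ae_pos hexp0] with ω hω
    have hone : ∀ m, Ψ m (Z ω, (fun i => R i ω), (fun k => U k ω), (fun k => S k ω)) ≤
        {ω | x < max ((queueNumber n Z ord R U S t ω : ℝ) - n) 0}.indicator 1 ω := by
      intro m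
      simp only [hΨ, averageAtTime]
      split_ifs with hm
      · refine averageAlive_le fun e _ => ?_
        by_cases hg : ((fun a => Sum.elim (fun i : Fin (Z ω) => R i ω - h)
            (fun k : Fin m => S k ω - (h - eventTime (fun k => U k ω) k)) (e a)),
            interEventAfter m h (fun k => U k ω), fun k => S (m + k) ω) ∈ overloadSet n x s
        · have hmem : ω ∈ {ω | x < max ((queueNumber n Z ord R U S t ω : ℝ) - n) 0} := by
            refine lt_numberInSystem_of_mem_overloadSet (h := h) (r := fun i => R i ω)
              (s := fun k => S k ω) hx hh0 (by linarith) (hQ.bijOn_ord (Z ω) ω) hω hm e ?_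
            rw [hh, sub_sub_cancel]
            exact hg
          rw [Set.indicator_of_mem hmem]
          exact Set.indicator_le_self _ _ _
        · rw [hΓ, Set.indicator_of_notMem hg]
          exact zero_le
      · exact zero_le
    by_cases hex : ∃ m, ArrivedUpTo m h (fun k => U k ω)
    · obtain ⟨m, hm⟩ := hex
      rw [tsum_eq_single m]
      · exact hone m
      · intro m' hm'
        simp only [hΨ, averageAtTime]
        rw [if_neg]
        intro hm2
        apply hm'
        rw [← eventCount_eq ((arrivedUpTo_iff hω m h).1 hm),
          ← eventCount_eq ((arrivedUpTo_iff hω m' h).1 hm2)]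
    · push Not at hex
      refine le_of_eq_of_le (ENNReal.tsum_eq_zero.2 fun m => ?_) zero_le
      simp only [hΨ, averageAtTime]
      rw [if_neg (hex m)]
  calc P {ω | n ≤ Z ω} * P' {ω | x < (eventCount (fun j => a j ω) s : ℝ) -
        ∑ i : Fin n, (eventCount (fun j => v i j ω) s : ℝ)}
      ≤ poissonMeasure (μA / μS).toNNReal {z | n ≤ z} *
        ∫⁻ y, ∫⁻ U, ∫⁻ S, Γ (y, U, S) ∂iidLaw ν ∂iidLaw (expMeasure μA)
          ∂Measure.pi (fun _ => residualLife ν) := by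
        refine mul_le_mul' (le_of_eq ?_) (measure_renewal_le_lintegral_overloadSet hμA hν_pos
          ha hv hv_indep hav_indep hx s)
        rw [← hQ.law_Z, Measure.map_apply hQ.measurable_Z MeasurableSet.of_discrete]
        rfl
    _ = ∑' z, ∑' m, poissonMeasure (μA / μS).toNNReal {z} *
        ∫⁻ x, ∫⁻ U, ∫⁻ S, averageAtTime Γ h z m x U S ∂iidLaw ν ∂iidLaw (expMeasure μA)
          ∂Measure.pi (fun _ => residualLife ν) :=
        (tsum_poissonMeasure_mul_lintegral_averageAtTime hμA hμS hν_mean hΓm hh0).symm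
    _ = ∫⁻ ω, ∑' m, Ψ m (Z ω, (fun i => R i ω), (fun k => U k ω), (fun k => S k ω)) ∂P := by
        have hcm : ∀ m, Measurable fun ω =>
            Ψ m (Z ω, (fun i => R i ω), (fun k => U k ω), (fun k => S k ω)) := fun m =>
          (hΨm m).comp (hQ.measurable_Z.prodMk (hmR.prodMk (hmU.prodMk hmS)))
        rw [ENNReal.tsum_comm, lintegral_tsum fun m => (hcm m).aemeasurable]
        exact tsum_congr fun m => (hΨint m).symm
    _ ≤ ∫⁻ ω, {ω | x < max ((queueNumber n Z ord R U S t ω : ℝ) - n) 0}.indicator 1 ω ∂P :=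
        lintegral_mono_ae hle
    _ ≤ _ := lintegral_indicator_one_le _

end

theorem theorem4
    -- number of servers, arrival rate, and processing time distribution
    (n : ℕ) (hn : 0 < n) (μA μS : ℝ) (hμA : 0 < μA) (hμS : 0 < μS)
    (ν : Measure ℝ) [IsProbabilityMeasure ν] (hν_pos : ν (Set.Iic 0) = 0)
    (hν_int : Integrable (fun x : ℝ => x) ν) (hν_mean : ∫ x, x ∂ν = μS⁻¹)
    -- the queue
    {Ω : Type*} [MeasurableSpace Ω] (P : Measure Ω) [IsProbabilityMeasure P]
    (Z : Ω → ℕ) (ord : ℕ → ℕ → Ω → ℕ) (R U S : ℕ → Ω → ℝ)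
    (hQ : IsMGInData P n μA μS ν Z ord R U S)
    -- the independent equilibrium renewal processes `A` and `N_i`
    {Ω' : Type*} [MeasurableSpace Ω'] (P' : Measure Ω') [IsProbabilityMeasure P']
    (a : ℕ → Ω' → ℝ) (v : Fin n → ℕ → Ω' → ℝ)
    (ha : IsEquilibriumRenewal P' (expMeasure μA) a)
    (hv : ∀ i, IsEquilibriumRenewal P' ν (v i))
    (hv_indep : iIndepFun (fun i ω => (fun j => v i j ω : ℕ → ℝ)) P')
    (hav_indep : IndepFun (fun ω => (fun j => a j ω : ℕ → ℝ))
      (fun ω => (fun i j => v i j ω : Fin n → ℕ → ℝ)) P')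
    -- a candidate for the steady state
    {Ω'' : Type*} [MeasurableSpace Ω''] (P'' : Measure Ω'') [IsProbabilityMeasure P'']
    (Qinf : Ω'' → ℝ) :
    (∀ x : ℝ, 0 < x → ∀ t : ℝ, 0 ≤ t →
      P {ω | n ≤ Z ω} *
          ⨆ s ∈ Set.Icc (0 : ℝ) t,
            P' {ω | x < (eventCount (fun j => a j ω) s : ℝ) -
              ∑ i : Fin n, (eventCount (fun j => v i j ω) s : ℝ)}
        ≤ P {ω | x < max ((queueNumber n Z ord R U S t ω : ℝ) - n) 0}) ∧
    (TendstoInDistribution (fun (t : ℝ) ω => (queueNumber n Z ord R U S t ω : ℝ)) Filter.atTop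
        Qinf (fun _ => P) P'' →
      ∀ x : ℝ, 0 < x →
        P {ω | n ≤ Z ω} *
            ⨆ t ∈ Set.Ici (0 : ℝ),
              P' {ω | x < (eventCount (fun j => a j ω) t : ℝ) -
                ∑ i : Fin n, (eventCount (fun j => v i j ω) t : ℝ)}
          ≤ P'' {ω | x < max (Qinf ω - n) 0}) := by
  have : NeZero n := ⟨hn.ne'⟩
  have key : ∀ x : ℝ, 0 < x → ∀ s t : ℝ, 0 ≤ s → s ≤ t → P {ω | n ≤ Z ω} *
      P' {ω | x < (eventCount (fun j => a j ω) s : ℝ) -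
        ∑ i : Fin n, (eventCount (fun j => v i j ω) s : ℝ)} ≤
      P {ω | x < max ((queueNumber n Z ord R U S t ω : ℝ) - n) 0} := fun x hx s t hs hst =>
    mul_measure_renewal_le_measure_waiting n hμA hμS ν hν_pos hν_mean P Z ord R U S hQ P' a v ha hv
      hv_indep hav_indep hx hs hst
  refine ⟨fun x hx t _ => ?_, fun hconv x hx => ?_⟩
  · simp only [ENNReal.mul_iSup]
    exact iSup₂_le fun s hs => key x hx s t hs.1 hs.2
  · simp only [ENNReal.mul_iSup]
    refine iSup₂_le fun s hs => ?_
    -- `Q₂(t)` is an integer, so `Q₂(t) - n > x` is the closed condition `Q₂(t) ≥ m`.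
    set m : ℕ := ⌊(n : ℝ) + x⌋₊ + 1 with hm
    have hmx : (n : ℝ) + x < m := by
      rw [hm]; push_cast; exact Nat.lt_floor_add_one _
    have hclosed : IsClosed (Set.Ici (m : ℝ)) := isClosed_Ici
    have hlim := ProbabilityMeasure.limsup_measure_closed_le_of_tendsto hconv.tendsto hclosed
    have hQm : AEMeasurable Qinf P'' := hconv.aemeasurable_limit
    have hbound : ∀ t, s ≤ t → P {ω | n ≤ Z ω} *
        P' {ω | x < (eventCount (fun j => a j ω) s : ℝ) -
          ∑ i : Fin n, (eventCount (fun j => v i j ω) s : ℝ)} ≤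
        P.map (fun ω => (queueNumber n Z ord R U S t ω : ℝ)) (Set.Ici (m : ℝ)) := by
      intro t hst
      rw [Measure.map_apply_of_aemeasurable (hconv.forall_aemeasurable t) measurableSet_Ici]
      refine (key x hx s t hs hst).trans (measure_mono fun ω hω => ?_)
      have h1 : (n : ℝ) + x < queueNumber n Z ord R U S t ω := by
        rcases lt_max_iff.1 (show x < max _ _ from hω) with h | h
        · linarith
        · exact absurd h (not_lt.2 hx.le)
      have h2 : ⌊(n : ℝ) + x⌋₊ < queueNumber n Z ord R U S t ω :=
        (Nat.floor_lt (by positivity)).2 h1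
      have h3 : (m : ℝ) ≤ queueNumber n Z ord R U S t ω := by exact_mod_cast h2
      exact h3
    have hle : P {ω | n ≤ Z ω} *
        P' {ω | x < (eventCount (fun j => a j ω) s : ℝ) -
          ∑ i : Fin n, (eventCount (fun j => v i j ω) s : ℝ)} ≤
        P''.map Qinf (Set.Ici (m : ℝ)) := by
      refine le_trans ?_ hlim
      refine Filter.le_limsup_of_frequently_le (Filter.Eventually.frequently ?_)
      filter_upwards [Filter.eventually_ge_atTop s] with t hst
      exact hbound t hst
    refine hle.trans ?_
    rw [Measure.map_apply_of_aemeasurable hQm measurableSet_Ici]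
    refine measure_mono fun ω hω => ?_
    have h1 : (m : ℝ) ≤ Qinf ω := hω
    have h2 : x < Qinf ω - n := by linarith
    exact lt_max_of_lt_left h2
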